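/- Let $p$ be a prime and $n\ge 1$. Let $\mathcal T$ and $\mathcal R$ be integrally closed domains that are finite extensions of $\mathbb Z_p[[u_1,\dots,u_n]]$ and $\mathbb Z_p[[v_1,\dots,v_{n-1}]]$ respectively. Let $\varpi:\mathcal T\to\mathcal R$ be a ring homomorphism whose kernel is a prime ideal of height one and which makes $\mathcal R$ the integral closure of $\mathcal T/\ker\varpi$ in its field of fractions. For an integrally closed noetherian domain $A$, the divisor group of $A$ is the free abelian group on the set of height one primes of $A$, ordered coefficientwise; for a finitely generated torsion $A$-module $N$ put $\mathrm{Div}(N)=\sum_{\mathfrak p}\mathrm{length}_{A_{\mathfrak p}}(N_{\mathfrak p})\cdot\mathfrak p$, the sum over the height one primes $\mathfrak p$ of $A$. A finitely generated torsion module $N$ is pseudo-null if $\mathrm{Div}(N)=0$. For a finitely generated $\mathcal T$-module $N$ consider the conditions: (No-PN) for every height two prime $Q\supseteq\ker\varpi$ of $\mathcal T$, the $\mathcal T_Q$-module $N_Q$ has no nonzero pseudo-null submodule; (Fin-Proj) for every height two prime $Q\supseteq\ker\varpi$ of $\mathcal T$, the $\mathcal T_Q$-module $N_Q$ has finite projective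 dimension. Let $Y_1,Y_2,M$ be finitely generated torsion $\mathcal T$-modules such that 1. $\ker\varpi$ does not belong to the support of $Y_1$, $Y_2$ or $M$; 2. $Y_1$ and $Y_2$ satisfy (No-PN) and (Fin-Proj); 3. for every height two prime $Q\supseteq\ker\varpi$ of $\mathcal T$ in the support of $M$, the local ring $\mathcal T_Q$ is regular and the domain $(\mathcal T/\ker\varpi)_Q$ is integrally closed. Then $Y_1\otimes_{\mathcal T}\mathcal R$, $Y_2\otimes_{\mathcal T}\mathcal R$, $M\otimes_{\mathcal T}\mathcal R$ and $\mathrm{Tor}_1^{\mathcal T}(\mathcal R,M)$ are finitely generated torsion $\mathcal R$-modules, and, for $\bowtie$ denoting either $\ge$ or $\le$ throughout, if $$\mathrm{Div}(Y_1)\ \bowtie\ \mathrm{Div}(Y_2)-\mathrm{Div}(M)$$ in the divisor group of $\mathcal T$, then $$\mathrm{Div}(Y_1\otimes_{\mathcal T}\mathcal R)\ \bowtie\ \mathrm{Div}(Y_2\otimes_{\mathcal T}\mathcal R)+\mathrm{Div}\big(\mathrm{Tor}_1^{\mathcal T}(\mathcal R,M)\big)-\mathrm{Div}(M\otimes_{\mathcal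 T}\mathcal R)$$ in the divisor group of $\mathcal R$. -/

import Mathlib

open scoped TensorProduct

universe u v

noncomputable section

/-- The set of height one prime ideals of a commutative ring `A`. -/
abbrev HeightOnePrime (A : Type u) [CommRing A] : Type u :=
  {p : PrimeSpectrum A // p.asIdeal.height = 1}

/-- The divisor group of `A`: the free abelian group on the set of height one primes of `A`.
It carries the coefficientwise partial order. -/
abbrev DivisorGroup (A : Type u) [CommRing A] : Type u := HeightOnePrime A →₀ ℤ

/-- The local length of `M` at a prime `p`, that is, the length of the `A_p`-module `M_p`. -/
def localLength (A : Type u) [CommRing A] (M : Type v) [AddCommGroup M] [Module A M]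
    (p : PrimeSpectrum A) : ℕ∞ :=
  Module.length (Localization.AtPrime p.asIdeal) (LocalizedModule p.asIdeal.primeCompl M)

open Classical in
/-- The divisor `Div(M) = ∑ len_{A_p}(M_p) · p`, the sum over the height one primes `p` of `A`.
It is meant for finitely generated torsion modules `M` over a noetherian domain `A`; then all the
lengths are finite and almost all of them vanish, see `localLength_ne_top` and `divisor_apply`. -/
def divisor (A : Type u) [CommRing A] (M : Type v) [AddCommGroup M] [Module A M] : DivisorGroup A :=
  if h : (Function.support fun p : HeightOnePrime A => ((localLength A M p.1).toNat : ℤ)).Finite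
  then Finsupp.ofSupportFinite _ h else 0

/-- A nonzero element of `A` that annihilates a given finitely generated torsion module. -/
theorem exists_annihilator_ne_zero (A : Type u) [CommRing A] [IsDomain A]
    (M : Type v) [AddCommGroup M] [Module A M] [Module.Finite A M] (hM : Module.IsTorsion A M) :
    ∃ a : A, a ≠ 0 ∧ ∀ m : M, a • m = 0 := by
  obtain ⟨a, ha, ha'⟩ := Submodule.annihilator_top_inter_nonZeroDivisors hM
  refine ⟨a, nonZeroDivisors.ne_zero ha', fun m => ?_⟩
  exact (Submodule.mem_annihilator.mp ha) m trivial

/-- The local lengths of a finitely generated torsion module at height one primes are finite. -/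
theorem localLength_ne_top (A : Type u) [CommRing A] [IsDomain A] [IsNoetherianRing A]
    (M : Type v) [AddCommGroup M] [Module A M] [Module.Finite A M] (hM : Module.IsTorsion A M)
    (p : HeightOnePrime A) : localLength A M p.1 ≠ ⊤ := by
  obtain ⟨a, ha, hM'⟩ := exists_annihilator_ne_zero A M hM
  let P := p.1.asIdeal
  let B := Localization.AtPrime P
  let N := LocalizedModule P.primeCompl M
  let b : B := algebraMap A B a
  have hb : b ∈ nonZeroDivisors B := mem_nonZeroDivisors_of_ne_zero
    ((IsLocalization.injective B P.primeCompl_le_nonZeroDivisors).ne_iff' (map_zero _) |>.mpr ha)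
  have hdim : Ring.KrullDimLE 1 B := by
    rw [Ring.krullDimLE_iff, IsLocalization.AtPrime.ringKrullDim_eq_height P B, p.2]
    rfl
  have hart : IsArtinian B (B ⧸ Ideal.span {b}) :=
    (isFiniteLength_iff_isNoetherian_isArtinian.mp
      (isFiniteLength_quotient_span_singleton B hb)).2
  have hN : Module.IsTorsionBySet B N (Ideal.span {b} : Ideal B) := by
    rw [Module.isTorsionBySet_span_singleton_iff]
    intro x
    induction x using LocalizedModule.induction_on with
    | h m s =>
      change algebraMap A B a • LocalizedModule.mk m s = 0
      rw [algebraMap_smul, LocalizedModule.smul'_mk, hM', LocalizedModule.zero_mk]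
  let _ : Module (B ⧸ Ideal.span {b}) N := hN.module
  have : IsScalarTower B (B ⧸ Ideal.span {b}) N := hN.isScalarTower
  have : Module.Finite B N := inferInstance
  have : Module.Finite (B ⧸ Ideal.span {b}) N := Module.Finite.of_restrictScalars_finite B _ N
  obtain ⟨k, f, hf⟩ := Module.Finite.exists_fin' (B ⧸ Ideal.span {b}) N
  have : IsArtinian B N := isArtinian_of_surjective _ (f.restrictScalars B) hf
  change Module.length B N ≠ ⊤
  rw [Module.length_ne_top_iff, isFiniteLength_iff_isNoetherian_isArtinian]
  exact ⟨inferInstance, inferInstance⟩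

/-- Almost all local lengths of a finitely generated torsion module at height one primes vanish. -/
theorem finite_support_localLength (A : Type u) [CommRing A] [IsDomain A] [IsNoetherianRing A]
    (M : Type v) [AddCommGroup M] [Module A M] [Module.Finite A M] (hM : Module.IsTorsion A M) :
    (Function.support fun p : HeightOnePrime A => ((localLength A M p.1).toNat : ℤ)).Finite := by
  obtain ⟨a, ha, hM'⟩ := exists_annihilator_ne_zero A M hM
  refine Set.Finite.of_finite_image (f := fun p : HeightOnePrime A => p.1.asIdeal)
    ((Ideal.finite_minimalPrimes_of_isNoetherianRing A (Ideal.span {a})).subset ?_)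
    (fun p _ q _ h => Subtype.ext (PrimeSpectrum.ext h))
  rintro _ ⟨p, hp, rfl⟩
  have hap : a ∈ p.1.asIdeal := by
    by_contra hap
    apply hp
    have : Subsingleton (LocalizedModule p.1.asIdeal.primeCompl M) :=
      LocalizedModule.subsingleton_iff.mpr fun m => ⟨a, hap, hM' m⟩
    simp [localLength, Module.length_eq_zero]
  refine ⟨⟨p.1.isPrime, by simpa [Ideal.span_le] using hap⟩, ?_⟩
  rintro q ⟨hq, haq⟩ hqp
  rcases hqp.eq_or_lt with h | h
  · exact h.ge
  · have hlt := Ideal.height_strict_mono_of_isPrime_of_isPrime h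
    rw [p.2, Order.lt_one_iff, Ideal.height_eq_zero_iff] at hlt
    rw [IsDomain.minimalPrimes_eq_singleton_bot, Set.mem_singleton_iff] at hlt
    subst hlt
    exact absurd (haq (Ideal.mem_span_singleton_self a)) (by simpa using ha)

/-- The coefficients of the divisor of a finitely generated torsion module. -/
theorem divisor_apply (A : Type u) [CommRing A] [IsDomain A] [IsNoetherianRing A]
    (M : Type v) [AddCommGroup M] [Module A M] [Module.Finite A M] (hM : Module.IsTorsion A M)
    (p : HeightOnePrime A) : divisor A M p = ((localLength A M p.1).toNat : ℤ) := by
  unfold divisor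
  rw [dif_pos (finite_support_localLength A M hM)]
  rfl

/-- A pseudo-null module: a finitely generated torsion module whose divisor is zero. -/
def IsPseudoNull (A : Type u) [CommRing A] (M : Type v) [AddCommGroup M] [Module A M] : Prop :=
  Module.Finite A M ∧ Module.IsTorsion A M ∧ divisor A M = 0

/-- Condition No-PN relative to a prime `P` of `T`: for every height two prime `Q` of `T` that
contains `P`, the `T_Q`-module `N_Q` has no nonzero pseudo-null submodule. -/
def NoPN (T : Type u) [CommRing T] (P : Ideal T) (N : Type v) [AddCommGroup N] [Module T N] :
    Prop :=
  ∀ (Q : Ideal T) [Q.IsPrime], Q.height = 2 → P ≤ Q →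
    ∀ Z : Submodule (Localization.AtPrime Q) (LocalizedModule Q.primeCompl N),
      IsPseudoNull (Localization.AtPrime Q) Z → Z = ⊥

/-- Condition Fin-Proj relative to a prime `P` of `T`: for every height two prime `Q` of `T` that
contains `P`, the `T_Q`-module `N_Q` has finite projective dimension. -/
def FinProj (T : Type u) [CommRing T] (P : Ideal T) (N : Type u) [AddCommGroup N] [Module T N] :
    Prop :=
  ∀ (Q : Ideal T) [Q.IsPrime], Q.height = 2 → P ≤ Q →
    ∃ d : ℕ, CategoryTheory.HasProjectiveDimensionLE
      (ModuleCat.of (Localization.AtPrime Q) (LocalizedModule Q.primeCompl N)) d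

instance extendScalars_additive (T R : Type u) [CommRing T] [CommRing R] (f : T →+* R) :
    (ModuleCat.extendScalars.{u, u, u} f).Additive where
  map_add {X Y g h} := by
    algebraize [f]
    ext x
    exact TensorProduct.tmul_add _ _ _

/-- `Tor_1^T(R, M)` as an `R`-module: the first left derived functor of `R ⊗_T -`, which goes from
`T`-modules to `R`-modules, evaluated at `M`. -/
abbrev TorOne (T R : Type u) [CommRing T] [CommRing R] [Algebra T R]
    (M : Type u) [AddCommGroup M] [Module T M] : ModuleCat.{u} R :=
  ((ModuleCat.extendScalars.{u, u, u} (algebraMap T R)).leftDerived 1).obj (ModuleCat.of T M)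

end

/-! Divisors of `R` are compared at one height one prime `q` at a time. Put `Q = q ∩ T`, `S = T_Q`,
`V = R_q`; `V` is a discrete valuation ring. The prime `Q` has height two. It strictly contains `ker
ϖ`, by incomparability. Conversely `T/Q` has dimension at least `n` when `R` is finite over power
series in `n` variables, while `T` has dimension at most `n + 2`; this rests on normality of the
power series rings and on a coheight bound for their height one primes. So `S` is a normal local
domain of dimension two.

For `Y = Y₁, Y₂`, (No-PN) gives `Y_Q` positive depth, so finite projective dimension forces a
presentation `0 → S^m → S^m → Y_Q → 0` (Auslander-Buchsbaum in depth two). The determinant `f` of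
the matrix computes the length of `Y` at each height one prime of `S`, and its image in `V` computes
the length of `V ⊗ Y`.

For `M` with `Q` in its support, `S` is regular, hence `ker (S → V) = (π)`, and `V = S/π` because
`(T/ker ϖ)_Q` is normal. With `N = M_Q`, the Euler characteristic `length (N/πN) - length (N[π])` is
additive, and dévissage to the modules `S/p` identifies it with `ord_V g`, where `g` generates the
divisor of `N`. The term `N[π]` has the length of `Tor₁(R, M)` at `q`. If `M_Q = 0`, take `g = 1`.

The hypothesis, read at the height one primes inside `Q`, says that `f₂` and `f₁ g` have comparable
orders at all height one primes of `S`. Since `S` is normal, one divides the other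
(`dvd_of_forall_ord_le`). Divisibility survives the map `S → V`, and taking `ord_V` gives the
inequality at `q`; it is carried out in `localLength_comparison`. -/

noncomputable section

open IsLocalRing

/-! ### Noetherian normal domains: height one primes and divisibility -/

section NormalDomains

variable {S : Type*} [CommRing S] [IsDomain S] [IsNoetherianRing S] [IsIntegrallyClosed S]

/-- In a local noetherian normal domain, a colon ideal `(b : a)` that equals the maximal ideal
forces the maximal ideal to be principal. -/
theorem maximalIdeal_isPrincipal_of_dvd_mul [IsLocalRing S] {a b : S} (hb : b ≠ 0)
    (hab : ¬ b ∣ a) (h : ∀ m ∈ maximalIdeal S, b ∣ m * a) : (maximalIdeal S).IsPrincipal := by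
  -- For `x = a / b`, `m x` is an ideal of `S`. If it is all of `S`, some `t x` is a unit and `t`
  -- generates `m`. Otherwise `m x ⊆ m`, so the determinant trick makes `x` integral, and normality
  -- gives `b ∣ a`.
  by_cases hu : ∃ t ∈ maximalIdeal S, ∃ u : S, IsUnit u ∧ t * a = b * u
  · obtain ⟨t, ht, u, hu, htu⟩ := hu
    refine ⟨t, le_antisymm (fun m hm => ?_) ?_⟩
    · obtain ⟨c, hc⟩ := h m hm
      obtain ⟨w, rfl⟩ := hu
      refine Ideal.mem_span_singleton.mpr ⟨↑w⁻¹ * c, ?_⟩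
      have h1 : b * (m * w) = b * (t * c) := by linear_combination (-m) * htu + t * hc
      have h2 := mul_left_cancel₀ hb h1
      calc m = (m * w) * ↑w⁻¹ := by simp [mul_assoc]
        _ = _ := by rw [h2]; ring
    · exact (Ideal.span_singleton_le_iff_mem _).mpr ht
  · push Not at hu
    by_cases hm0 : maximalIdeal S = ⊥
    · rw [hm0]; exact bot_isPrincipal
    exfalso
    have hb' : algebraMap S (FractionRing S) b ≠ 0 := by simpa using hb
    let x : FractionRing S := algebraMap S (FractionRing S) a / algebraMap S (FractionRing S) b
    have hx : IsIntegral S x := by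
      let f := Algebra.linearMap S (FractionRing S)
      refine isIntegral_of_smul_mem_submodule (M := FractionRing S) (Submodule.map f (maximalIdeal S)) ?_ ?_ x ?_
      · obtain ⟨y, hy, hy0⟩ := Submodule.exists_mem_ne_zero_of_ne_bot hm0
        intro h0
        have : f y ∈ Submodule.map f (maximalIdeal S) := Submodule.mem_map_of_mem hy
        rw [h0, Submodule.mem_bot] at this
        exact hy0 (by simpa [f] using this)
      · exact Submodule.FG.map _ (IsNoetherian.noetherian _)
      · rintro _ ⟨m, hm, rfl⟩
        obtain ⟨c, hc⟩ := h m hm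
        refine ⟨c, ?_, ?_⟩
        · by_contra hcm
          exact hu m hm c (by simpa using hcm) hc
        · have := congrArg (algebraMap S (FractionRing S)) hc
          simp only [map_mul] at this
          simp only [f, Algebra.linearMap_apply, smul_eq_mul, x]
          field_simp
          linear_combination -this
    obtain ⟨y, hy⟩ := IsIntegrallyClosed.isIntegral_iff.mp hx
    refine hab ⟨y, ?_⟩
    apply IsFractionRing.injective S (FractionRing S)
    rw [map_mul, hy]
    exact (mul_div_cancel₀ _ hb').symm

theorem localization_atPrime_isDiscreteValuationRing (p : Ideal S) [p.IsPrime] (hp : p.height = 1) :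
    IsDiscreteValuationRing (Localization.AtPrime p) := by
  have hdim : ringKrullDim (Localization.AtPrime p) = 1 := by
    rw [IsLocalization.AtPrime.ringKrullDim_eq_height p, hp]; rfl
  have : IsDomain (Localization.AtPrime p) := inferInstance
  have : IsNoetherianRing (Localization.AtPrime p) :=
    IsLocalization.isNoetherianRing p.primeCompl _ inferInstance
  have : IsIntegrallyClosed (Localization.AtPrime p) :=
    isIntegrallyClosed_of_isLocalization _ p.primeCompl p.primeCompl_le_nonZeroDivisors
  have hnf : ¬ IsField (Localization.AtPrime p) := fun h => by
    rw [ringKrullDim_eq_zero_of_isField h] at hdim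
    exact zero_ne_one hdim
  have htfae : IsDiscreteValuationRing (Localization.AtPrime p) ↔
      IsIntegrallyClosed (Localization.AtPrime p) ∧
        ∃! P : Ideal (Localization.AtPrime p), P ≠ ⊥ ∧ P.IsPrime :=
    (IsDiscreteValuationRing.TFAE _ hnf).out 0 3
  refine htfae.mpr ⟨inferInstance, maximalIdeal (Localization.AtPrime p), ⟨?_, inferInstance⟩, ?_⟩
  · exact fun h => hnf (IsLocalRing.isField_iff_maximalIdeal_eq.mpr h)
  · rintro q ⟨hq0, hq⟩
    have h1 : Ring.KrullDimLE 1 (Localization.AtPrime p) := by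
      rw [Ring.krullDimLE_iff, hdim]; rfl
    by_contra hne
    have hlt : q < maximalIdeal _ := lt_of_le_of_ne (le_maximalIdeal hq.ne_top) hne
    have h2 := Ideal.height_add_one_le_of_lt_of_isPrime hlt
    have h3 : (maximalIdeal (Localization.AtPrime p)).height = 1 := by
      have := maximalIdeal_height_eq_ringKrullDim (R := Localization.AtPrime p)
      rw [hdim] at this
      exact_mod_cast this
    rw [h3] at h2
    have h4 : q.height = 0 := by
      have : q.height + 1 ≤ 0 + 1 := by simpa using h2
      simpa using (ENat.add_le_add_iff_right (by simp)).mp this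
    exact hq0 (Ideal.height_eq_zero_iff_eq_bot.mp h4)

/-- Serre's condition `S₂`: in a noetherian normal domain, the associated primes of a nonzero
principal ideal have height one. -/
theorem height_eq_one_of_mem_iff_dvd_mul {p : Ideal S} [p.IsPrime] {a b : S} (hb : b ≠ 0)
    (h : ∀ x, x ∈ p ↔ b ∣ x * a) : p.height = 1 := by
  let B := Localization.AtPrime p
  have : IsNoetherianRing B := IsLocalization.isNoetherianRing p.primeCompl _ inferInstance
  have : IsIntegrallyClosed B :=
    isIntegrallyClosed_of_isLocalization _ p.primeCompl p.primeCompl_le_nonZeroDivisors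
  have hinj : Function.Injective (algebraMap S B) :=
    IsLocalization.injective B p.primeCompl_le_nonZeroDivisors
  have hbp : b ∈ p := (h b).mpr (dvd_mul_right _ _)
  have hprin : (maximalIdeal B).IsPrincipal := by
    apply maximalIdeal_isPrincipal_of_dvd_mul (a := algebraMap S B a) (b := algebraMap S B b)
    · exact (hinj.ne_iff' (map_zero _)).mpr hb
    · rintro ⟨c, hc⟩
      obtain ⟨c', s, rfl⟩ := IsLocalization.exists_mk'_eq p.primeCompl c
      rw [← sub_eq_zero] at hc
      have h1 : algebraMap S B (s * a) = algebraMap S B (b * c') := by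
        rw [map_mul, map_mul, ← IsLocalization.mk'_spec' B c' s]
        linear_combination (algebraMap S B s) * hc
      exact s.2 ((h s).mpr ⟨c', hinj h1⟩)
    · intro m hm
      obtain ⟨m', s, rfl⟩ := IsLocalization.exists_mk'_eq p.primeCompl m
      rw [IsLocalization.AtPrime.mk'_mem_maximal_iff B p] at hm
      obtain ⟨c, hc⟩ := (h m').mp hm
      refine ⟨IsLocalization.mk' B c s, ?_⟩
      have := congrArg (algebraMap S B) hc
      rw [map_mul, map_mul] at this
      rw [IsLocalization.mk'_eq_mul_mk'_one m', IsLocalization.mk'_eq_mul_mk'_one c]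
      linear_combination (IsLocalization.mk' B 1 s) * this
  refine le_antisymm ?_ ?_
  · have h1 : (maximalIdeal B).height ≤ 1 :=
      Ideal.height_le_one_of_isPrincipal_of_mem_minimalPrimes (maximalIdeal B) _
        (by simp [Ideal.minimalPrimes_eq_subsingleton_self])
    have h2 := IsLocalization.height_under p.primeCompl (maximalIdeal B)
    rw [IsLocalization.AtPrime.under_maximalIdeal B p] at h2
    rw [h2]; exact h1
  · rw [Order.one_le_iff_ne_zero, Ne, Ideal.height_eq_zero_iff_eq_bot]
    rintro rfl
    exact hb hbp

/-- This is `S = ⋂ S_p` over height one primes. If `f ∤ g`, some associated prime `p` of `S/f`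
contains the annihilator of the class of `g`, and `p` has height one by `S₂`; divisibility in the
valuation ring `S_p` yields `s ∉ p` with `f ∣ s g`, a contradiction. -/
theorem dvd_of_forall_ord_le {f g : S} (hf : f ≠ 0)
    (h : ∀ (p : Ideal S) [p.IsPrime], p.height = 1 →
      Ring.ord (Localization.AtPrime p) (algebraMap S _ f) ≤
        Ring.ord (Localization.AtPrime p) (algebraMap S _ g)) : f ∣ g := by
  by_contra hfg
  have hne : Ideal.Quotient.mk (Ideal.span {f}) g ≠ 0 := by
    rwa [Ne, Ideal.Quotient.eq_zero_iff_dvd]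
  obtain ⟨p, hp, hle⟩ := exists_le_isAssociatedPrime_of_isNoetherianRing S
    (Ideal.Quotient.mk (Ideal.span {f}) g) hne
  obtain ⟨hprime, x, hx⟩ := isAssociatedPrime_iff.mp hp
  obtain ⟨c, rfl⟩ := Ideal.Quotient.mk_surjective x
  have hmem (y z : S) : y ∈ (⊥ : Submodule S (S ⧸ Ideal.span {f})).colon
      {Ideal.Quotient.mk (Ideal.span {f}) z} ↔ f ∣ y * z := by
    rw [Submodule.mem_colon_singleton, Submodule.mem_bot, ← Ideal.Quotient.eq_zero_iff_dvd, map_mul]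
    rfl
  have hht : p.height = 1 :=
    height_eq_one_of_mem_iff_dvd_mul hf (fun y => by rw [hx]; exact hmem y c)
  have := localization_atPrime_isDiscreteValuationRing p hht
  have hinj : Function.Injective (algebraMap S (Localization.AtPrime p)) :=
    IsLocalization.injective _ p.primeCompl_le_nonZeroDivisors
  have h1 := h p hht
  rw [Ring.ord_eq_addVal, Ring.ord_eq_addVal, IsDiscreteValuationRing.addVal_le_iff_dvd] at h1
  obtain ⟨d, hd⟩ := h1
  obtain ⟨d', s, rfl⟩ := IsLocalization.exists_mk'_eq p.primeCompl d
  refine s.2 (hle ((hmem s g).mpr ⟨d', hinj ?_⟩))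
  rw [map_mul, map_mul, hd, ← IsLocalization.mk'_spec' _ d' s]
  ring

end NormalDomains

/-! ### Regular sequences of length two -/

section Depth

variable {S : Type*} [CommRing S] [IsLocalRing S] [IsNoetherianRing S]

/-- A finitely generated module over a noetherian local ring has either a regular element in the
maximal ideal or a nonzero socle. -/
theorem exists_isSMulRegular_or_exists_socle (N : Type*) [AddCommGroup N] [Module S N]
    [Module.Finite S N] : (∃ x ∈ maximalIdeal S, IsSMulRegular N x) ∨
      ∃ z : N, z ≠ 0 ∧ ∀ m ∈ maximalIdeal S, m • z = 0 := by
  by_cases h : Subsingleton ((S ⧸ maximalIdeal S) →ₗ[S] N)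
  · left
    obtain ⟨r, hr, hr'⟩ := IsSMulRegular.subsingleton_linearMap_iff.mp h
    exact ⟨r, by simpa [Ideal.annihilator_quotient] using hr, hr'⟩
  · right
    rw [not_subsingleton_iff_nontrivial] at h
    obtain ⟨φ, hφ⟩ := exists_ne (0 : (S ⧸ maximalIdeal S) →ₗ[S] N)
    refine ⟨φ 1, fun h0 => hφ ?_, fun m hm => ?_⟩
    · ext
      simpa using h0
    · rw [← map_smul, ← map_zero φ]
      congr 1
      rw [Algebra.smul_def, mul_one]
      exact Ideal.Quotient.eq_zero_iff_mem.mpr hm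

/-- In a noetherian local normal domain of dimension two every nonzero element of the maximal ideal
is the beginning of a regular sequence `x, y`, and the maximal ideal is associated to `(x, y)`. -/
theorem exists_regular_pair [IsDomain S] [IsIntegrallyClosed S]
    (hdim : (maximalIdeal S).height = 2) {x : S} (hx : x ≠ 0) (hxm : x ∈ maximalIdeal S) :
    ∃ y ∈ maximalIdeal S, (∀ a, x ∣ y * a → x ∣ a) ∧
      ∃ s, s ∉ Ideal.span {x, y} ∧ ∀ m ∈ maximalIdeal S, m * s ∈ Ideal.span {x, y} := by
  -- A socle element of `S/x` would make the maximal ideal associated to `(x)`, hence of height one.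
  rcases exists_isSMulRegular_or_exists_socle (S := S) (S ⧸ Ideal.span {x}) with
    ⟨y, hy, hreg⟩ | ⟨z, hz, hz'⟩
  · have hyreg : ∀ a, x ∣ y * a → x ∣ a := by
      intro a ha
      rw [← Ideal.Quotient.eq_zero_iff_dvd] at ha ⊢
      apply hreg
      simpa [Algebra.smul_def] using ha
    refine ⟨y, hy, hyreg, ?_⟩
    have hle : Ideal.span {x, y} ≤ maximalIdeal S := by
      rw [Ideal.span_le]; rintro t (rfl | rfl) <;> assumption
    have hnt : Nontrivial (S ⧸ Ideal.span {x, y}) :=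
      Ideal.Quotient.nontrivial_iff.mpr (ne_top_of_le_ne_top (maximalIdeal.isMaximal S).ne_top hle)
    obtain ⟨p, hp⟩ := associatedPrimes.nonempty S (S ⧸ Ideal.span {x, y})
    obtain ⟨hprime, c, hc⟩ := isAssociatedPrime_iff.mp hp
    obtain ⟨s, rfl⟩ := Ideal.Quotient.mk_surjective c
    have hmem (t : S) : t ∈ p ↔ t * s ∈ Ideal.span {x, y} := by
      rw [hc, Submodule.mem_colon_singleton, Submodule.mem_bot, ← Ideal.Quotient.eq_zero_iff_mem,
        map_mul]
      rfl
    have hxyp : Ideal.span {x, y} ≤ p := fun t ht => (hmem t).mpr (Ideal.mul_mem_right _ _ ht)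
    -- A smaller `p` has height at most one, so it is minimal over `x` and associated to `S/x`. It
    -- then consists of zero divisors on `S/x`, although it contains the regular element `y`.
    have hpm : p = maximalIdeal S := by
      by_contra hne
      have hlt : p < maximalIdeal S := lt_of_le_of_ne (le_maximalIdeal hprime.ne_top) hne
      have h1 := Ideal.height_add_one_le_of_lt_of_isPrime hlt
      rw [hdim, ← one_add_one_eq_two] at h1
      have h2 : p.height ≤ 1 := (ENat.add_le_add_iff_right (by simp)).mp h1
      have hxp : x ∈ p := hxyp (Ideal.subset_span (by simp))
      have hmin : p ∈ (Ideal.span {x}).minimalPrimes := by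
        refine Ideal.mem_minimalPrimes_of_height_le (by simpa [Ideal.span_le] using hxp) ?_
        refine h2.trans (Ideal.one_le_height_span_singleton_of_mem_nonZeroDivisors ?_)
        exact mem_nonZeroDivisors_of_ne_zero hx
      have hass := Module.associatedPrimes.minimalPrimes_annihilator_subset_associatedPrimes S
        (S ⧸ Ideal.span {x}) (by rwa [Ideal.annihilator_quotient])
      obtain ⟨-, w, hw⟩ := isAssociatedPrime_iff.mp hass
      have hyp : y ∈ p := hxyp (Ideal.subset_span (by simp))
      rw [hw, Submodule.mem_colon_singleton, Submodule.mem_bot] at hyp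
      have hw0 : w = 0 := hreg (by simpa using hyp)
      apply hprime.ne_top
      rw [hw, hw0]; simp
    subst hpm
    exact ⟨s, fun hs => hprime.ne_top (Ideal.eq_top_of_isUnit_mem _ ((hmem 1).mpr (by simpa))
      isUnit_one), fun m hm => (hmem m).mp hm⟩
  · exfalso
    obtain ⟨a, rfl⟩ := Ideal.Quotient.mk_surjective z
    rw [Ne, Ideal.Quotient.eq_zero_iff_dvd] at hz
    have := height_eq_one_of_mem_iff_dvd_mul (p := maximalIdeal S) (a := a) hx (fun m => ?_)
    · rw [hdim] at this; exact absurd this (by decide)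
    · constructor
      · intro hm
        rw [← Ideal.Quotient.eq_zero_iff_dvd, map_mul]
        simpa [Algebra.smul_def] using hz' m hm
      · rintro hd
        by_contra hm
        have hu : IsUnit m := by simpa using hm
        exact hz ((hu.dvd_mul_left).mp hd)

end Depth

theorem one_tmul_eq_zero_iff_mem_ker_smul_top {S A K : Type*} [CommRing S] [CommRing A] [Algebra S A]
    [AddCommGroup K] [Module S K] (hA : Function.Surjective (algebraMap S A)) (v : K) :
    (1 : A) ⊗ₜ[S] v = 0 ↔ v ∈ RingHom.ker (algebraMap S A) • (⊤ : Submodule S K) := by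
  let I := RingHom.ker (algebraMap S A)
  let e : (S ⧸ I) ≃ₗ[S] A :=
    (Ideal.quotientKerAlgEquivOfSurjective (f := Algebra.ofId S A) hA).toLinearEquiv
  have he : e 1 = 1 := map_one (Ideal.quotientKerAlgEquivOfSurjective (f := Algebra.ofId S A) hA)
  let e' := (TensorProduct.congr e (LinearEquiv.refl S K)).symm ≪≫ₗ
    TensorProduct.quotTensorEquivQuotSMul K I
  have : e' (1 ⊗ₜ v) = Submodule.Quotient.mk v := by
    have h1 : (TensorProduct.congr e (LinearEquiv.refl S K)).symm ((1 : A) ⊗ₜ v) = 1 ⊗ₜ v := by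
      rw [LinearEquiv.symm_apply_eq, TensorProduct.congr_tmul, he]; rfl
    simp only [e', LinearEquiv.trans_apply, h1]
    exact TensorProduct.quotTensorEquivQuotSMul_mk_tmul I 1 v |>.trans (by simp)
  rw [← Submodule.Quotient.mk_eq_zero, ← this, LinearEquiv.map_eq_zero_iff]

/-! ### Auslander-Buchsbaum in depth two -/

section FiniteProjectiveDimension

variable {S : Type u} [CommRing S]

/-- The pair `x, y` is a weakly regular sequence on `K`. -/
def IsRegularPair (x y : S) (K : Type*) [AddCommGroup K] [Module S K] : Prop :=
  (∀ k : K, x • k = 0 → k = 0) ∧ ∀ k k' : K, y • k = x • k' → ∃ k'' : K, k = x • k''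

theorem IsRegularPair.pi {x y : S} {K : Type*} [AddCommGroup K] [Module S K]
    (h : IsRegularPair x y K) (ι : Type*) : IsRegularPair x y (ι → K) := by
  refine ⟨fun k hk => funext fun i => h.1 _ (congrFun hk i), fun k k' hk => ?_⟩
  choose f hf using fun i => h.2 (k i) (k' i) (congrFun hk i)
  exact ⟨f, funext hf⟩

/-- A first syzygy gains depth: if `k = x c` lies in the kernel, then `x g(c) = 0`, so regularity of
`x` alone on `K` puts `c` in the kernel. -/
theorem IsRegularPair.ker {x y : S} {F K : Type*} [AddCommGroup K] [Module S K] [AddCommGroup F]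
    [Module S F] (hF : IsRegularPair x y F) (g : F →ₗ[S] K) (hK : ∀ k : K, x • k = 0 → k = 0) :
    IsRegularPair x y (LinearMap.ker g) := by
  refine ⟨fun k hk => Subtype.ext (hF.1 k (congrArg Subtype.val hk)), fun k k' hk => ?_⟩
  obtain ⟨c, hc⟩ := hF.2 k k' (congrArg Subtype.val hk)
  refine ⟨⟨c, hK _ ?_⟩, Subtype.ext hc⟩
  rw [← map_smul, ← hc]
  exact k.2

variable [IsLocalRing S] [IsNoetherianRing S]

/-- The key case of the Auslander-Buchsbaum formula: if the maximal ideal is associated to a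
regular sequence `x, y`, then a finitely generated module of finite projective dimension on which
`x, y` is regular is free. -/
theorem IsRegularPair.free_of_hasProjectiveDimensionLE {x y s : S} (hS : IsRegularPair x y S)
    (hs : s ∉ Ideal.span {x, y}) (hsm : ∀ m ∈ maximalIdeal S, m * s ∈ Ideal.span {x, y})
    (d : ℕ) (K : Type u) [AddCommGroup K] [Module S K] [Module.Finite S K]
    (hK : IsRegularPair x y K)
    (hd : CategoryTheory.HasProjectiveDimensionLE (ModuleCat.of S K) d) : Module.Free S K := by
  induction d generalizing K with
  | zero =>
    have : CategoryTheory.Projective (ModuleCat.of S K) := by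
      unfold CategoryTheory.HasProjectiveDimensionLE at hd
      infer_instance
    have : Module.Projective S K := (IsProjective.iff_projective K).mpr this
    exact Module.free_of_flat_of_isLocalRing
  | succ d ih =>
    obtain ⟨m, g, hg⟩ := Module.Finite.exists_fin' S K
    have hF := hS.pi (Fin m)
    have hker := hF.ker g hK.1
    have hfree : Module.Free S (LinearMap.ker g) := by
      refine ih _ hker ?_
      have hex := LinearMap.shortExact_shortComplexKer hg
      exact hex.hasProjectiveDimensionLT_X₁ (d + 1)
        (by
          have : CategoryTheory.Projective (ModuleCat.of S (Fin m → S)) :=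
            (IsProjective.iff_projective _).mp inferInstance
          exact CategoryTheory.hasProjectiveDimensionLT_of_ge _ 1 _ (by omega)) hd
    -- With `ker g` free, freeness of `K` reduces to `ker g ∩ m S^m ⊆ m ker g`. The presentation
    -- need not be minimal.
    refine Module.free_of_lTensor_residueField_injective (LinearMap.ker g).subtype g hg
      (LinearMap.exact_subtype_ker_map g) ?_
    rw [injective_iff_map_eq_zero]
    intro t ht
    have hsurj : Function.Surjective (algebraMap S (ResidueField S)) := residue_surjective
    obtain ⟨v, rfl⟩ := TensorProduct.mk_surjective S _ (ResidueField S) hsurj t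
    have hkr : RingHom.ker (algebraMap S (ResidueField S)) = maximalIdeal S := ker_residue
    simp only [TensorProduct.mk_apply, LinearMap.lTensor_tmul] at ht ⊢
    rw [one_tmul_eq_zero_iff_mem_ker_smul_top hsurj, hkr] at ht ⊢
    have h1 : ∀ w ∈ maximalIdeal S • (⊤ : Submodule S (Fin m → S)),
        ∃ a b : Fin m → S, s • w = x • a + y • b := by
      intro w hw
      refine Submodule.smul_induction_on hw (fun r hr n _ => ?_) ?_
      · obtain ⟨c, d, hcd⟩ := Ideal.mem_span_pair.mp (hsm r hr)
        exact ⟨c • n, d • n, by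
          rw [smul_smul, mul_comm s, ← hcd, add_smul, smul_smul, smul_smul, mul_comm x, mul_comm y]⟩
      · rintro n n' ⟨a, b, h⟩ ⟨a', b', h'⟩
        exact ⟨a + a', b + b', by rw [smul_add, h, h']; simp only [smul_add]; abel⟩
    -- The vectors `a`, `b` need not lie in `ker g`. Regularity of `x, y` on `K` provides `c` for
    -- which the Koszul correction `a + y c`, `b - x c` does, without changing `x a + y b`.
    obtain ⟨a, b, hab⟩ := h1 _ ht
    have hgab : y • g b = x • (- g a) := by
      have := congrArg g hab
      simp only [map_smul, map_add] at this
      rw [show g ((LinearMap.ker g).subtype v) = 0 from v.2, smul_zero] at this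
      rw [smul_neg, eq_neg_iff_add_eq_zero, add_comm, ← this]
    obtain ⟨c, hc⟩ := hK.2 _ _ hgab
    obtain ⟨c, rfl⟩ := hg c
    have hga : g a + y • g c = 0 := hK.1 _ (by
      rw [smul_add, smul_comm, ← hc, hgab, smul_neg, add_neg_cancel])
    let k1 : LinearMap.ker g := ⟨b - x • c, by simp [hc]⟩
    let k2 : LinearMap.ker g := ⟨a + y • c, by simpa using hga⟩
    have hv : s • v = x • k2 + y • k1 := by
      apply Subtype.ext
      change s • (LinearMap.ker g).subtype v = x • (a + y • c) + y • (b - x • c)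
      rw [hab, smul_add, smul_sub, smul_comm y x c]; abel
    let B := Module.Free.chooseBasis S (LinearMap.ker g)
    rw [← B.sum_repr v]
    refine Submodule.sum_mem _ fun i _ => Submodule.smul_mem_smul ?_ trivial
    -- A unit coordinate of `v` would turn `s v ∈ (x, y) ker g` into `s ∈ (x, y)`.
    by_contra hu
    have hu : IsUnit (B.repr v i) := by simpa using hu
    have h2 := congrArg (fun w => B.repr w i) hv
    simp only [map_smul, map_add, Finsupp.smul_apply, Finsupp.add_apply, smul_eq_mul] at h2
    apply hs
    rw [← Ideal.mul_unit_mem_iff_mem _ hu, h2]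
    exact Ideal.mem_span_pair.mpr ⟨B.repr k2 i, B.repr k1 i, by ring⟩

end FiniteProjectiveDimension

/-! ### Determinants and lengths of cokernels -/

section Determinant

/-- Smith normal form: the cokernel is a product of cyclic modules `V / a i`, and `∏ a i` agrees
with the determinant up to a unit. -/
theorem length_quotient_range_mulVecLin {V : Type*} [CommRing V] [IsDomain V]
    [IsPrincipalIdealRing V] {m : ℕ} (A : Matrix (Fin m) (Fin m) V) (hA : A.det ≠ 0) :
    Module.length V ((Fin m → V) ⧸ LinearMap.range A.mulVecLin) = Ring.ord V A.det := by
  have hinj : Function.Injective A.mulVecLin := by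
    rw [injective_iff_map_eq_zero]
    intro v hv
    by_contra hne
    exact hA (Matrix.exists_mulVec_eq_zero_iff.mp ⟨v, hne, hv⟩)
  let N := LinearMap.range A.mulVecLin
  let φ : (Fin m → V) ≃ₗ[V] N := LinearEquiv.ofInjective _ hinj
  have hrank : Module.finrank V N = Module.finrank V (Fin m → V) := φ.finrank_eq.symm
  let b := Pi.basisFun V (Fin m)
  let a := Submodule.smithNormalFormCoeffs b hrank
  let b' := Submodule.smithNormalFormTopBasis b hrank
  let ab := Submodule.smithNormalFormBotBasis b hrank
  have hab : ∀ i, (ab i : Fin m → V) = a i • b' i := Submodule.smithNormalFormBotBasis_def b hrank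
  have hassoc : Associated A.det (∏ i, a i) := by
    rw [← LinearMap.det_toLin' A, ← Matrix.det_diagonal, ← LinearMap.det_toLin b' (Matrix.diagonal a)]
    -- This automorphism sends `b' i` to the preimage under `A` of `a i • b' i`, so `A ∘ e` is
    -- diagonal in the basis `b'`.
    let e := (b'.equiv ab (Equiv.refl _)) ≪≫ₗ φ.symm
    refine (LinearMap.associated_det_of_eq_comp e _ _ ?_).symm
    suffices h : Matrix.toLin b' b' (Matrix.diagonal a) = (Matrix.toLin' A) ∘ₗ e.toLinearMap from
      fun x => LinearMap.congr_fun h x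
    refine b'.ext fun i => ?_
    have h1 : Matrix.toLin' A (φ.symm (ab i)) = ab i :=
      congrArg Subtype.val (φ.apply_symm_apply (ab i))
    simp only [e, LinearMap.comp_apply, LinearEquiv.coe_coe, LinearEquiv.trans_apply,
      Module.Basis.equiv_apply, Equiv.refl_apply, h1, hab]
    simp [Matrix.toLin_apply, Pi.single_apply, Finsupp.single_eq_pi_single]
  rw [(Submodule.quotientEquivPiSpan N b hrank).length_eq, Module.length_pi_of_fintype,
    Ring.ord_eq_of_associated hassoc]
  have hprod : ∀ s : Finset (Fin m), Ring.ord V (∏ i ∈ s, a i) = ∑ i ∈ s, Ring.ord V (a i) := by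
    intro s
    induction s using Finset.cons_induction with
    | empty => simp
    | cons i s his ih =>
      rw [Finset.prod_cons, Finset.sum_cons, Ring.ord_mul, ih]
      exact mem_nonZeroDivisors_of_ne_zero (Finset.prod_ne_zero_iff.mpr fun j _ =>
        Submodule.smithNormalFormCoeffs_ne_zero b hrank j)
  rw [hprod]
  rfl

/-- A torsion module with a presentation by free modules `0 → K → Sᵐ → N → 0` has a generator of
its Fitting ideal that computes the lengths of all base changes to principal ideal domains. -/
theorem exists_length_tensorProduct_eq_ord {S : Type u} [CommRing S] [IsDomain S]
    [IsNoetherianRing S] {N : Type u} [AddCommGroup N] [Module S N] (hN : Module.IsTorsion S N)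
    {m : ℕ} (g : (Fin m → S) →ₗ[S] N) (hg : Function.Surjective g)
    [Module.Free S (LinearMap.ker g)] :
    ∃ f : S, f ≠ 0 ∧ ∀ (V : Type u) [CommRing V] [IsDomain V] [IsPrincipalIdealRing V] [Algebra S V],
      algebraMap S V f ≠ 0 → Module.length V (V ⊗[S] N) = Ring.ord V (algebraMap S V f) := by
  classical
  -- Torsion of `N` makes the presentation matrix square.
  have hrank : Module.finrank S (LinearMap.ker g) = m := by
    have h1 := rank_quotient_add_rank_of_isDomain (LinearMap.ker g)
    have h2 : Module.rank S ((Fin m → S) ⧸ LinearMap.ker g) = 0 := by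
      rw [(g.quotKerEquivOfSurjective hg).rank_eq]
      exact Module.rank_eq_zero_iff_isTorsion.mpr hN
    rw [h2, zero_add] at h1
    rw [Module.finrank, h1]
    simp
  let B := Module.finBasisOfFinrankEq S (LinearMap.ker g) hrank
  let φ : (Fin m → S) →ₗ[S] (Fin m → S) :=
    (LinearMap.ker g).subtype ∘ₗ (B.equivFun.symm : (Fin m → S) →ₗ[S] LinearMap.ker g)
  have hrange : LinearMap.range φ = LinearMap.ker g := by
    rw [LinearMap.range_comp, LinearEquiv.range, Submodule.map_top, Submodule.range_subtype]
  have hφinj : Function.Injective φ := Subtype.val_injective.comp B.equivFun.symm.injective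
  let A := LinearMap.toMatrix' φ
  have hφA : A.mulVecLin = φ := Matrix.toLin'_toMatrix' φ
  refine ⟨A.det, fun h0 => ?_, fun V _ _ _ _ hV => ?_⟩
  · obtain ⟨v, hv, hv'⟩ := Matrix.exists_mulVec_eq_zero_iff.mpr h0
    exact hv ((injective_iff_map_eq_zero φ).mp hφinj v (by rw [← hφA]; exact hv'))
  · have hdet : algebraMap S V A.det = (A.map (algebraMap S V)).det := by
      rw [RingHom.map_det]; rfl
    rw [hdet] at hV ⊢
    rw [← length_quotient_range_mulVecLin _ hV]
    let e := TensorProduct.piScalarRight S V V (Fin m)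
    let ψ : (Fin m → V) →ₗ[V] V ⊗[S] N := (g.baseChange V) ∘ₗ e.symm.toLinearMap
    have hψ : Function.Surjective ψ :=
      (LinearMap.lTensor_surjective V hg).comp e.symm.surjective
    have hcomm : (A.map (algebraMap S V)).mulVecLin ∘ₗ e.toLinearMap =
        e.toLinearMap ∘ₗ φ.baseChange V := by
      ext i j
      simp [e, A, Matrix.mulVec, dotProduct, LinearMap.toMatrix'_apply, Pi.single_apply,
        Algebra.smul_def]
    -- Right exactness suffices to present `V ⊗ N` by the same matrix, so `V` need not be flat over
    -- `S`.
    have hker : LinearMap.ker ψ = LinearMap.range (A.map (algebraMap S V)).mulVecLin := by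
      have hex : Function.Exact φ g := by
        rw [LinearMap.exact_iff, hrange]
      have hexV : Function.Exact (φ.baseChange V) (g.baseChange V) := lTensor_exact V hex hg
      ext w
      obtain ⟨w, rfl⟩ := e.surjective w
      simp only [ψ, LinearMap.mem_ker, LinearMap.comp_apply, LinearEquiv.coe_coe,
        LinearEquiv.symm_apply_apply]
      rw [hexV w]
      constructor
      · rintro ⟨z, rfl⟩
        exact ⟨e z, LinearMap.congr_fun hcomm z⟩
      · rintro ⟨z, hz⟩
        obtain ⟨z, rfl⟩ := e.surjective z
        exact ⟨z, e.injective ((LinearMap.congr_fun hcomm z).symm.trans hz)⟩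
    rw [← hker]
    exact (ψ.quotKerEquivOfSurjective hψ).length_eq.symm

end Determinant

/-! ### Principal Fitting ideals in dimension two -/

section PseudoNull

variable {S : Type u} [CommRing S] [IsDomain S] [IsLocalRing S] [IsNoetherianRing S]

/-- A module killed by the maximal ideal vanishes at every height one prime, since such a prime
cannot contain an ideal of height two. -/
theorem isPseudoNull_span_singleton_of_smul_eq_zero (hdim : (maximalIdeal S).height = 2)
    {N : Type v} [AddCommGroup N] [Module S N] {z : N} (hz : ∀ m ∈ maximalIdeal S, m • z = 0) :
    IsPseudoNull S (Submodule.span S {z}) := by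
  have hkill : ∀ m ∈ maximalIdeal S, ∀ w : Submodule.span S {z}, m • w = 0 := by
    rintro m hm ⟨w, hw⟩
    obtain ⟨c, rfl⟩ := Submodule.mem_span_singleton.mp hw
    exact Subtype.ext (by
      change m • c • z = 0
      rw [smul_comm, hz m hm, smul_zero])
  have hm0 : maximalIdeal S ≠ ⊥ := fun h => by
    rw [h, Ideal.height_bot] at hdim; exact absurd hdim (by decide)
  obtain ⟨y, hy, hy0⟩ := Submodule.exists_mem_ne_zero_of_ne_bot hm0
  have htors : Module.IsTorsion S (Submodule.span S {z}) := fun {w} =>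
    ⟨⟨y, mem_nonZeroDivisors_of_ne_zero hy0⟩, hkill y hy w⟩
  refine ⟨inferInstance, htors, ?_⟩
  ext p
  rw [divisor_apply S _ htors]
  obtain ⟨t, htm, htp⟩ : ∃ t ∈ maximalIdeal S, t ∉ p.1.asIdeal := by
    by_contra! hle
    have := Ideal.height_mono (show maximalIdeal S ≤ p.1.asIdeal from hle)
    rw [hdim, p.2] at this
    exact absurd this (by decide)
  have : Subsingleton (LocalizedModule p.1.asIdeal.primeCompl (Submodule.span S {z})) :=
    LocalizedModule.subsingleton_iff.mpr fun w => ⟨t, htp, hkill t htm w⟩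
  simp [localLength, Module.length_eq_zero]

/-- Over a noetherian local normal domain of dimension two, a torsion module of finite projective
dimension without pseudo-null submodules has a principal Fitting ideal, and its generator computes
the lengths of all base changes to principal ideal domains. -/
theorem exists_length_tensorProduct_eq_ord_of_noPseudoNull [IsIntegrallyClosed S]
    (hdim : (maximalIdeal S).height = 2) {N : Type u} [AddCommGroup N] [Module S N]
    [Module.Finite S N] (hN : Module.IsTorsion S N)
    (hPN : ∀ Z : Submodule S N, IsPseudoNull S Z → Z = ⊥) {d : ℕ}
    (hd : CategoryTheory.HasProjectiveDimensionLE (ModuleCat.of S N) d) :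
    ∃ f : S, f ≠ 0 ∧ ∀ (V : Type u) [CommRing V] [IsDomain V] [IsPrincipalIdealRing V] [Algebra S V],
      algebraMap S V f ≠ 0 → Module.length V (V ⊗[S] N) = Ring.ord V (algebraMap S V f) := by
  have hm0 : maximalIdeal S ≠ ⊥ := fun h => by
    rw [h, Ideal.height_bot] at hdim; exact absurd hdim (by decide)
  obtain ⟨x, hx0, hxm, hx⟩ : ∃ x : S, x ≠ 0 ∧ x ∈ maximalIdeal S ∧ IsSMulRegular N x := by
    rcases exists_isSMulRegular_or_exists_socle (S := S) N with ⟨x, hxm, hx⟩ | ⟨z, hz0, hz⟩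
    -- If `0` is regular on `N`, then `N = 0` and any nonzero `y` in the maximal ideal serves.
    · by_cases hx0 : x = 0
      · obtain ⟨y, hy, hy0⟩ := Submodule.exists_mem_ne_zero_of_ne_bot hm0
        refine ⟨y, hy0, hy, fun a b _ => hx (by simp [hx0])⟩
      · exact ⟨x, hx0, hxm, hx⟩
    · have := hPN _ (isPseudoNull_span_singleton_of_smul_eq_zero hdim hz)
      exact absurd (Submodule.span_singleton_eq_bot.mp this) hz0
  obtain ⟨y, -, hyreg, s, hs, hsm⟩ := exists_regular_pair hdim hx0 hxm
  have hS : IsRegularPair x y S := by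
    refine ⟨fun k hk => ?_, fun k k' hk => ?_⟩
    · exact (mul_eq_zero.mp hk).resolve_left hx0
    · exact hyreg k ⟨k', hk⟩
  obtain ⟨m, g, hg⟩ := Module.Finite.exists_fin' S N
  have hker : IsRegularPair x y (LinearMap.ker g) :=
    (hS.pi (Fin m)).ker g (fun k hk => hx (by simpa using hk))
  -- The bound `d` could be lowered for a syzygy, but only finiteness matters.
  have hpd : CategoryTheory.HasProjectiveDimensionLE (ModuleCat.of S (LinearMap.ker g)) d := by
    have hex := LinearMap.shortExact_shortComplexKer hg
    have : CategoryTheory.Projective (ModuleCat.of S (Fin m → S)) :=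
      (IsProjective.iff_projective _).mp inferInstance
    refine hex.hasProjectiveDimensionLT_X₁ (d + 1)
      (CategoryTheory.hasProjectiveDimensionLT_of_ge _ 1 _ (by omega)) ?_
    exact CategoryTheory.hasProjectiveDimensionLT_of_ge _ (d + 1) _ (by omega)
  have := hS.free_of_hasProjectiveDimensionLE hs hsm d (LinearMap.ker g) hker hpd
  exact exists_length_tensorProduct_eq_ord hN g hg

end PseudoNull

/-! ### Lengths, base change and the Euler characteristic of multiplication by `π` -/

/-- Long exact sequences are cut into such pieces, so that lengths in `ℕ∞` are only added and never
subtracted. -/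
theorem Module.length_eq_add_range_of_exact {S A B C : Type*} [CommRing S] [AddCommGroup A]
    [Module S A] [AddCommGroup B] [Module S B] [AddCommGroup C] [Module S C] {f : A →ₗ[S] B}
    {g : B →ₗ[S] C} (h : Function.Exact f g) :
    Module.length S B =
      Module.length S (LinearMap.range f) + Module.length S (LinearMap.range g) := by
  refine Module.length_eq_add_of_exact (LinearMap.range f).subtype g.rangeRestrict
    Subtype.val_injective g.surjective_rangeRestrict ?_
  rw [LinearMap.exact_iff, LinearMap.ker_rangeRestrict, Submodule.range_subtype]
  exact LinearMap.exact_iff.mp h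

theorem Module.length_range_of_injective {S A B : Type*} [CommRing S] [AddCommGroup A]
    [Module S A] [AddCommGroup B] [Module S B] {f : A →ₗ[S] B} (h : Function.Injective f) :
    Module.length S (LinearMap.range f) = Module.length S A :=
  (LinearEquiv.ofInjective f h).length_eq.symm

theorem Module.length_range_of_surjective {S A B : Type*} [CommRing S] [AddCommGroup A]
    [Module S A] [AddCommGroup B] [Module S B] {f : A →ₗ[S] B} (h : Function.Surjective f) :
    Module.length S (LinearMap.range f) = Module.length S B :=
  (LinearEquiv.ofTop _ (LinearMap.range_eq_top.mpr h)).length_eq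

theorem length_tensorProduct_quotient_span_singleton {S : Type*} [CommRing S] (V : Type*)
    [CommRing V] [Algebra S V] (f : S) :
    Module.length V (V ⊗[S] (S ⧸ Ideal.span {f})) = Ring.ord V (algebraMap S V f) := by
  rw [← (Ideal.qoutMapEquivTensorQout V (I := Ideal.span {f})).length_eq, Ideal.map_span,
    Set.image_singleton]
  rfl

theorem length_tensorProduct_eq_zero {S : Type*} [CommRing S] {V : Type*} [CommRing V]
    [Algebra S V] {N : Type*} [AddCommGroup N] [Module S N] {t : S} (ht : IsUnit (algebraMap S V t))
    (h : ∀ n : N, t • n = 0) : Module.length V (V ⊗[S] N) = 0 := by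
  rw [Module.length_eq_zero_iff]
  refine subsingleton_of_forall_eq 0 fun z => ?_
  have h1 : ∀ z : V ⊗[S] N, algebraMap S V t • z = 0 := by
    intro z
    induction z with
    | zero => simp
    | add a b ha hb => rw [smul_add, ha, hb, add_zero]
    | tmul a n =>
      rw [algebraMap_smul, ← TensorProduct.tmul_smul, h, TensorProduct.tmul_zero]
  exact (ht.smul_eq_zero).mp (h1 z)

theorem length_tensorProduct_add_of_exact {S : Type*} [CommRing S] (V : Type*) [CommRing V]
    [Algebra S V] [Module.Flat S V] {N₁ N₂ N₃ : Type*} [AddCommGroup N₁] [Module S N₁]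
    [AddCommGroup N₂] [Module S N₂] [AddCommGroup N₃] [Module S N₃] {f : N₁ →ₗ[S] N₂}
    {g : N₂ →ₗ[S] N₃} (hf : Function.Injective f) (hg : Function.Surjective g)
    (h : Function.Exact f g) :
    Module.length V (V ⊗[S] N₂) = Module.length V (V ⊗[S] N₁) + Module.length V (V ⊗[S] N₃) :=
  Module.length_eq_add_of_exact (f.baseChange V) (g.baseChange V)
    (Module.Flat.lTensor_preserves_injective_linearMap f hf)
    (LinearMap.lTensor_surjective V hg) (lTensor_exact V h hg)

section EulerCharacteristic

variable {S : Type u} [CommRing S] {V : Type u} [CommRing V] [Algebra S V] {π : S}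

theorem exact_lsmul_mk (hV : Function.Surjective (algebraMap S V))
    (hker : RingHom.ker (algebraMap S V) = Ideal.span {π}) (N : Type*) [AddCommGroup N]
    [Module S N] : Function.Exact (LinearMap.lsmul S N π) (TensorProduct.mk S V N 1) := by
  intro n
  rw [TensorProduct.mk_apply, one_tmul_eq_zero_iff_mem_ker_smul_top hV, hker,
    Submodule.ideal_span_singleton_smul, Submodule.mem_smul_pointwise_iff_exists]
  simp

/-- Additivity of the Euler characteristic `length (N / π N) - length (N[π])`. -/
theorem length_tensorProduct_eq_add_of_exact (hV : Function.Surjective (algebraMap S V))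
    (hker : RingHom.ker (algebraMap S V) = Ideal.span {π})
    {N₁ N₂ N₃ : Type v} [AddCommGroup N₁] [Module S N₁]
    [AddCommGroup N₂] [Module S N₂] [AddCommGroup N₃] [Module S N₃] {f : N₁ →ₗ[S] N₂}
    {g : N₂ →ₗ[S] N₃} (hf : Function.Injective f) (hg : Function.Surjective g)
    (h : Function.Exact f g) {o₁ o₃ : ℕ∞}
    (h₁ : Module.length S (V ⊗[S] N₁) =
      Module.length S (LinearMap.ker (LinearMap.lsmul S N₁ π)) + o₁)
    (h₃ : Module.length S (V ⊗[S] N₃) =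
      Module.length S (LinearMap.ker (LinearMap.lsmul S N₃ π)) + o₃) :
    Module.length S (V ⊗[S] N₂) =
      Module.length S (LinearMap.ker (LinearMap.lsmul S N₂ π)) + (o₁ + o₃) := by
  let K (N : Type v) [AddCommGroup N] [Module S N] := LinearMap.ker (LinearMap.lsmul S N π)
  let F₁ : K N₁ →ₗ[S] K N₂ := f.restrict (p := K N₁) (q := K N₂) (fun x hx => by
    have hx : π • x = 0 := hx
    change π • f x = 0
    rw [← map_smul, hx, map_zero])
  let F₂ : K N₂ →ₗ[S] K N₃ := g.restrict (p := K N₂) (q := K N₃) (fun x hx => by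
    have hx : π • x = 0 := hx
    change π • g x = 0
    rw [← map_smul, hx, map_zero])
  have hF₁ : Function.Injective F₁ := fun a b hab =>
    Subtype.ext (hf (congrArg Subtype.val hab))
  have hF : Function.Exact F₁ F₂ := by
    intro x
    constructor
    · intro hx
      obtain ⟨y, hy⟩ := (h x.1).mp (congrArg Subtype.val hx)
      refine ⟨⟨y, ?_⟩, Subtype.ext hy⟩
      change π • y = 0
      apply hf
      rw [map_smul, hy, map_zero]
      exact x.2
    · rintro ⟨y, rfl⟩
      exact Subtype.ext ((h (f y)).mpr ⟨_, rfl⟩)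
  let G₁ : V ⊗[S] N₁ →ₗ[S] V ⊗[S] N₂ := f.lTensor V
  let G₂ : V ⊗[S] N₂ →ₗ[S] V ⊗[S] N₃ := g.lTensor V
  have hG₂ : Function.Surjective G₂ := LinearMap.lTensor_surjective V hg
  have hG : Function.Exact G₁ G₂ := lTensor_exact V h hg
  have hι (N : Type v) [AddCommGroup N] [Module S N] :
      Function.Exact (K N).subtype (LinearMap.lsmul S N π) := LinearMap.exact_subtype_ker_map _
  have hc₁ : f ∘ₗ LinearMap.lsmul S N₁ π = LinearMap.lsmul S N₂ π ∘ₗ f := by ext; simp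
  have hc₂ : g ∘ₗ LinearMap.lsmul S N₂ π = LinearMap.lsmul S N₃ π ∘ₗ g := by ext; simp
  -- Snake lemma for multiplication by `π` on the given sequence; its cokernels are `N/πN = V ⊗ N`.
  let δ : K N₃ →ₗ[S] V ⊗[S] N₁ := SnakeLemma.δ' (LinearMap.lsmul S N₁ π) (LinearMap.lsmul S N₂ π)
    (LinearMap.lsmul S N₃ π) f g h f g h hc₁ hc₂ (K N₃).subtype (hι N₃)
    (TensorProduct.mk S V N₁ 1) (exact_lsmul_mk hV hker N₁) hg hf
  have hδ₁ : Function.Exact F₂ δ := SnakeLemma.exact_δ'_right _ _ _ f g h f g h hc₁ hc₂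
    (K N₂).subtype (hι N₂) (K N₃).subtype (hι N₃) _ (exact_lsmul_mk hV hker N₁) hg hf F₂ rfl
    Subtype.val_injective
  have hδ₂ : Function.Exact δ G₁ := SnakeLemma.exact_δ'_left _ _ _ f g h f g h hc₁ hc₂
    (K N₃).subtype (hι N₃) (TensorProduct.mk S V N₁ 1) (exact_lsmul_mk hV hker N₁)
    (TensorProduct.mk S V N₂ 1) (exact_lsmul_mk hV hker N₂) hg hf G₁ (by ext; simp [G₁])
    (TensorProduct.mk_surjective S N₁ V hV)
  -- One equation for each of the four inner terms of `0 → N₁[π] → N₂[π] → N₃[π] → V ⊗ N₁ → V ⊗ N₂ →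
  -- V ⊗ N₃ → 0`.
  have e1 := Module.length_eq_add_range_of_exact hF
  have e2 := Module.length_eq_add_range_of_exact hδ₁
  have e3 := Module.length_eq_add_range_of_exact hδ₂
  have e4 := Module.length_eq_add_range_of_exact hG
  rw [Module.length_range_of_injective hF₁] at e1
  rw [Module.length_range_of_surjective hG₂] at e4
  change _ = Module.length S (K N₂) + _
  rw [e4, h₃, show Module.length S (LinearMap.ker (LinearMap.lsmul S N₃ π)) = _ from e2, e1]
  calc _ = (Module.length S (LinearMap.range δ) + Module.length S (LinearMap.range G₁)) +
        Module.length S (LinearMap.range F₂) + o₃ := by abel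
    _ = _ := by rw [← e3, h₁]; abel

/-- Both modules are `N` itself, so a module killed by `π` has Euler characteristic zero. -/
theorem length_tensorProduct_eq_length_ker_of_smul_eq_zero
    (hV : Function.Surjective (algebraMap S V))
    (hker : RingHom.ker (algebraMap S V) = Ideal.span {π})
    {N : Type*} [AddCommGroup N] [Module S N] (h : ∀ n : N, π • n = 0) :
    Module.length S (V ⊗[S] N) = Module.length S (LinearMap.ker (LinearMap.lsmul S N π)) := by
  have h1 : LinearMap.ker (LinearMap.lsmul S N π) = ⊤ := by
    ext n; simp [h]
  rw [h1, Module.length_top]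
  refine (LinearEquiv.ofBijective (TensorProduct.mk S V N 1) ⟨?_,
    TensorProduct.mk_surjective S N V hV⟩).length_eq.symm
  rw [injective_iff_map_eq_zero]
  intro n hn
  obtain ⟨n', rfl⟩ := (exact_lsmul_mk hV hker N n).mp hn
  exact h n'

end EulerCharacteristic

/-! ### Two-dimensional regular local rings and characteristic elements -/

section Regular

variable {S : Type u} [CommRing S] [IsDomain S]

/-- It is enough to treat primes. A prime `q` without `y` satisfies `q = y q`, so it vanishes by
Nakayama. -/
theorem isPrincipalIdealRing_of_maximalIdeal_le_span_singleton {B : Type*} [CommRing B]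
    [IsLocalRing B] [IsNoetherianRing B] {y : B} (hy : maximalIdeal B = Ideal.span {y}) :
    IsPrincipalIdealRing B := by
  refine IsPrincipalIdealRing.of_prime fun q hq => ?_
  by_cases hyq : y ∈ q
  · have : q = maximalIdeal B := le_antisymm (le_maximalIdeal hq.ne_top)
      (by rwa [hy, Ideal.span_singleton_le_iff_mem])
    rw [this, hy]
    exact ⟨⟨y, rfl⟩⟩
  · have : q = ⊥ := by
      rw [← le_bot_iff]
      refine Submodule.le_of_le_smul_of_le_jacobson_bot (I := maximalIdeal B)
        (IsNoetherian.noetherian _) (IsLocalRing.jacobson_eq_maximalIdeal _ bot_ne_top).ge ?_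
      intro t ht
      have h1 : t ∈ Ideal.span {y} := by rw [← hy]; exact le_maximalIdeal hq.ne_top ht
      obtain ⟨c, rfl⟩ := Ideal.mem_span_singleton'.mp h1
      have hc : c ∈ q := (hq.mem_or_mem ht).resolve_right hyq
      rw [bot_sup_eq, mul_comm, smul_eq_mul]
      exact Ideal.mul_mem_mul (by rw [hy]; exact Ideal.mem_span_singleton_self y) hc
    rw [this]
    exact bot_isPrincipal

/-- Height one primes of a two-dimensional regular local ring are principal. -/
theorem exists_eq_span_singleton_of_height_eq_one [IsRegularLocalRing S]
    (hdim : (maximalIdeal S).height = 2) (p : Ideal S) [p.IsPrime] (hp : p.height = 1) :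
    ∃ f, p = Ideal.span {f} := by
  classical
  have hrank : (maximalIdeal S).spanFinrank = 2 := by
    have h1 := IsRegularLocalRing.spanFinrank_maximalIdeal (R := S)
    rw [← maximalIdeal_height_eq_ringKrullDim, hdim] at h1
    exact_mod_cast h1
  obtain ⟨s, hs, hspan⟩ := Submodule.FG.exists_span_finset_card_eq_spanFinrank
    (IsNoetherian.noetherian (maximalIdeal S))
  rw [hrank] at hs
  obtain ⟨x, y, -, rfl⟩ := Finset.card_eq_two.mp hs
  have hspan : Ideal.span {x, y} = maximalIdeal S := by simpa using hspan
  -- Modulo `x` the maximal ideal is principal, so the image of `p` is generated by some `f ∈ p`. As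
  -- `x ∉ p`, this reads `p = (f) + x p`, and Nakayama gives `p = (f)`. Not both parameters lie in
  -- `p`.
  have key : ∀ x y : S, Ideal.span {x, y} = maximalIdeal S → x ∉ p → ∃ f, p = Ideal.span {f} := by
    intro x y hxy hxp
    have hxm : x ∈ maximalIdeal S := hxy ▸ Ideal.subset_span (by simp)
    let B := S ⧸ Ideal.span {x}
    have hnt : Nontrivial B := Ideal.Quotient.nontrivial_iff.mpr (by
      rw [Ne, Ideal.span_singleton_eq_top]; exact hxm)
    have hloc : IsLocalRing B :=
      IsLocalRing.of_surjective' (Ideal.Quotient.mk (Ideal.span {x})) Ideal.Quotient.mk_surjective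
    have hmB : maximalIdeal B = Ideal.span {Ideal.Quotient.mk _ y} := by
      have h1 : maximalIdeal B = (maximalIdeal S).map (Ideal.Quotient.mk (Ideal.span {x})) := by
          have h2 : (maximalIdeal B).comap (Ideal.Quotient.mk (Ideal.span {x})) = maximalIdeal S :=
            IsLocalRing.eq_maximalIdeal
              (Ideal.comap_isMaximal_of_surjective _ Ideal.Quotient.mk_surjective)
          rw [← h2, Ideal.map_comap_of_surjective _ Ideal.Quotient.mk_surjective]
      rw [h1, ← hxy, Ideal.map_span, Set.image_pair]
      simp
    have := isPrincipalIdealRing_of_maximalIdeal_le_span_singleton hmB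
    obtain ⟨g, hg⟩ := (IsPrincipalIdealRing.principal (p.map (Ideal.Quotient.mk (Ideal.span {x})))).1
    have hgm : g ∈ p.map (Ideal.Quotient.mk (Ideal.span {x})) := by
      rw [hg]; exact Submodule.mem_span_singleton_self g
    obtain ⟨f, hf, rfl⟩ :=
      (Ideal.mem_map_iff_of_surjective _ Ideal.Quotient.mk_surjective).mp hgm
    refine ⟨f, le_antisymm ?_ ((Ideal.span_singleton_le_iff_mem _).mpr hf)⟩
    refine Submodule.le_of_le_smul_of_le_jacobson_bot (I := maximalIdeal S)
      (IsNoetherian.noetherian _) (IsLocalRing.jacobson_eq_maximalIdeal _ bot_ne_top).ge ?_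
    intro a ha
    have h1 := Ideal.mem_map_of_mem (Ideal.Quotient.mk (Ideal.span {x})) ha
    rw [hg] at h1
    obtain ⟨c, hc⟩ := Submodule.mem_span_singleton.mp h1
    obtain ⟨c, rfl⟩ := Ideal.Quotient.mk_surjective c
    rw [smul_eq_mul, ← map_mul, Ideal.Quotient.eq, Ideal.mem_span_singleton] at hc
    obtain ⟨d, hd⟩ := hc
    have hdp : d ∈ p := by
      refine (Ideal.IsPrime.mem_or_mem ‹_› (?_ : x * d ∈ p)).resolve_left hxp
      rw [← hd]
      exact p.sub_mem (p.mul_mem_left _ hf) ha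
    rw [show a = c * f + x * (-d) by linear_combination -hd]
    refine Submodule.add_mem_sup (Ideal.mul_mem_left _ _ (Ideal.mem_span_singleton_self f)) ?_
    exact Submodule.smul_mem_smul hxm (p.neg_mem hdp)
  by_cases hx : x ∈ p
  · refine key y x (by rw [Set.pair_comm]; exact hspan) fun hy => ?_
    have hle : maximalIdeal S ≤ p := by
      rw [← hspan, Ideal.span_le]; rintro t (rfl | rfl) <;> assumption
    have := Ideal.height_mono hle
    rw [hdim, hp] at this
    exact absurd this (by decide)
  · exact key x y hspan hx

/-- On a two-dimensional regular local domain, a module `N` whose support does not contain the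
prime `(π)` has a characteristic element `f`: it generates the divisor of `N`, and its order in
`V = S / (π)` is `length (N / π N) - length (N[π])`. -/
theorem exists_characteristic_element [IsRegularLocalRing S]
    (hdim : (maximalIdeal S).height = 2) {V : Type u} [CommRing V] [IsDomain V] [Algebra S V] {π : S}
    (hV : Function.Surjective (algebraMap S V))
    (hker : RingHom.ker (algebraMap S V) = Ideal.span {π}) (hπ : (Ideal.span {π}).height = 1)
    (N : Type u) [AddCommGroup N] [Module S N] [hN : Module.Finite S N]
    (hs : ∃ s, algebraMap S V s ≠ 0 ∧ ∀ n : N, s • n = 0) :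
    ∃ f : S, algebraMap S V f ≠ 0 ∧
      (∀ (p : Ideal S) [p.IsPrime], p.height = 1 →
        Module.length (Localization.AtPrime p) (Localization.AtPrime p ⊗[S] N) =
          Ring.ord (Localization.AtPrime p) (algebraMap S _ f)) ∧
      Module.length S (V ⊗[S] N) =
        Module.length S (LinearMap.ker (LinearMap.lsmul S N π)) + Ring.ord V (algebraMap S V f) := by
  have hflat (p : Ideal S) [p.IsPrime] : Module.Flat S (Localization.AtPrime p) :=
    IsLocalization.flat _ p.primeCompl
  induction hN using IsNoetherianRing.induction_on_isQuotientEquivQuotientPrime with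
  | subsingleton N =>
    refine ⟨1, by simp, fun p _ _ => ?_, ?_⟩
    · rw [map_one, Ring.ord_one]
      exact length_tensorProduct_eq_zero (t := 1) (by simp) (fun n => Subsingleton.elim _ _)
    · rw [map_one, Ring.ord_one, add_zero]
      exact length_tensorProduct_eq_length_ker_of_smul_eq_zero hV hker
        (fun n => Subsingleton.elim _ _)
  | quotient N p e =>
    obtain ⟨s, hs0, hs⟩ := hs
    have hkill (t : S) (ht : t ∈ p.1) (n : N) : t • n = 0 := by
      apply e.injective
      obtain ⟨c, hc⟩ := Ideal.Quotient.mk_surjective (e n)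
      rw [map_smul, map_zero, ← hc, ← Ideal.Quotient.mk_eq_mk, ← Submodule.Quotient.mk_smul,
        Submodule.Quotient.mk_eq_zero]
      exact Ideal.mul_mem_right _ _ ht
    have hsp : s ∈ p.1 := by
      have h1 := congrArg e (hs (e.symm 1))
      rw [map_smul, LinearEquiv.apply_symm_apply, map_zero, Algebra.smul_def, mul_one] at h1
      exact Ideal.Quotient.eq_zero_iff_mem.mp h1
    have hpr := p.2
    -- The prime contains `s`, which is nonzero in `V`, so it is neither `0` nor `(π)`. The maximal
    -- ideal contributes `f = 1`; any other `p` is `(f)` of height one, and `π` acts injectively on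
    -- `S/p`.
    by_cases hpm : p.1 = maximalIdeal S
    · refine ⟨1, by simp, fun q _ hq => ?_, ?_⟩
      · rw [map_one, Ring.ord_one]
        obtain ⟨t, htm, htq⟩ : ∃ t ∈ maximalIdeal S, t ∉ q := by
          by_contra! hle
          have := Ideal.height_mono (show maximalIdeal S ≤ q from hle)
          rw [hdim, hq] at this
          exact absurd this (by decide)
        exact length_tensorProduct_eq_zero
          (IsLocalization.map_units (M := q.primeCompl) _ ⟨t, htq⟩) (hkill t (hpm ▸ htm))
      · rw [map_one, Ring.ord_one, add_zero]
        refine length_tensorProduct_eq_length_ker_of_smul_eq_zero hV hker (hkill π ?_)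
        rw [hpm, mem_maximalIdeal, mem_nonunits_iff, ← Ideal.span_singleton_eq_top]
        intro h
        rw [h, Ideal.height_top] at hπ
        exact absurd hπ (by decide)
    · have hpht : p.1.height = 1 := by
        have h1 := Ideal.height_add_one_le_of_lt_of_isPrime
          (lt_of_le_of_ne (le_maximalIdeal hpr.ne_top) hpm)
        rw [hdim, ← one_add_one_eq_two] at h1
        refine le_antisymm ((ENat.add_le_add_iff_right (by simp)).mp h1) ?_
        rw [Order.one_le_iff_ne_zero, Ne, Ideal.height_eq_zero_iff_eq_bot]
        intro h
        rw [h, Submodule.mem_bot] at hsp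
        exact hs0 (by rw [hsp, map_zero])
      obtain ⟨f, hf⟩ := exists_eq_span_singleton_of_height_eq_one hdim p.1 hpht
      have hπp : π ∉ p.1 := by
        intro hπp
        have hle : Ideal.span {π} ≤ p.1 := (Ideal.span_singleton_le_iff_mem _).mpr hπp
        have hprime : (Ideal.span {π}).IsPrime := hker ▸ RingHom.ker_isPrime _
        have : (Ideal.span {π}).FiniteHeight := by simp [Ideal.finiteHeight_iff, hπ]
        have heq : Ideal.span {π} = p.1 := Ideal.eq_of_le_of_height_le _ hle (by rw [hπ, hpht])
        rw [← heq, ← hker] at hsp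
        exact hs0 hsp
      have e' : N ≃ₗ[S] S ⧸ Ideal.span {f} := e ≪≫ₗ Submodule.quotEquivOfEq _ _ hf
      have hlen (W : Type u) [CommRing W] [Algebra S W] :
          Module.length W (W ⊗[S] N) = Ring.ord W (algebraMap S W f) := by
        rw [← length_tensorProduct_quotient_span_singleton W f]
        exact (e'.baseChange S W _ _).length_eq
      refine ⟨f, ?_, fun q _ hq => hlen _, ?_⟩
      · intro h
        have h1 : f ∈ Ideal.span {π} := hker ▸ h
        have hle : p.1 ≤ Ideal.span {π} := by rwa [hf, Ideal.span_singleton_le_iff_mem]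
        have h2 := hle hsp
        rw [← hker] at h2
        exact hs0 h2
      · rw [Module.length_eq_of_surjective hV, hlen V]
        have : Subsingleton (LinearMap.ker (LinearMap.lsmul S N π)) := by
          rw [Submodule.subsingleton_iff_eq_bot, Submodule.eq_bot_iff]
          intro n hn
          have hn : π • n = 0 := hn
          obtain ⟨c, hc⟩ := Ideal.Quotient.mk_surjective (e n)
          have h1 := congrArg e hn
          rw [map_smul, map_zero, ← hc, ← Ideal.Quotient.mk_eq_mk, ← Submodule.Quotient.mk_smul,
            Submodule.Quotient.mk_eq_zero] at h1
          have h2 := (hpr.mem_or_mem h1).resolve_left hπp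
          apply e.injective
          rw [map_zero, ← hc]
          exact Ideal.Quotient.eq_zero_iff_mem.mpr h2
        rw [Module.length_eq_zero, zero_add]
  | exact N₁ N₂ N₃ f g hf hg hfg ih₁ ih₃ =>
    obtain ⟨s, hs0, hs⟩ := hs
    obtain ⟨f₁, hf₁0, hf₁, hf₁'⟩ := ih₁ ⟨s, hs0, fun n => hf (by rw [map_smul, hs, map_zero])⟩
    obtain ⟨f₃, hf₃0, hf₃, hf₃'⟩ := ih₃ ⟨s, hs0, fun n => by
      obtain ⟨n, rfl⟩ := hg n
      rw [← map_smul, hs, map_zero]⟩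
    refine ⟨f₁ * f₃, by rw [map_mul]; exact mul_ne_zero hf₁0 hf₃0, fun p _ hp => ?_, ?_⟩
    · rw [length_tensorProduct_add_of_exact _ hf hg hfg, hf₁ p hp, hf₃ p hp, map_mul, Ring.ord_mul]
      refine mem_nonZeroDivisors_of_ne_zero ?_
      rw [Ne, IsLocalization.to_map_eq_zero_iff _ p.primeCompl_le_nonZeroDivisors]
      rintro rfl
      simp at hf₃0
    · rw [map_mul, Ring.ord_mul _ (mem_nonZeroDivisors_of_ne_zero hf₃0)]
      exact length_tensorProduct_eq_add_of_exact hV hker hf hg hfg hf₁' hf₃'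

end Regular

/-! ### `Tor₁` as a kernel -/

open CategoryTheory

section ExtendScalars
variable (T R : Type u) [CommRing T] [CommRing R] [Algebra T R]

/-- The scalars `R` in `ModuleCat.extendScalars`, with the `T`-action of the algebra `R`. -/
def restrictScalarsEquiv :
    ((ModuleCat.restrictScalars (algebraMap T R)).obj (ModuleCat.of R R)) ≃ₗ[T] R where
  toFun x := x
  invFun x := x
  map_add' _ _ := rfl
  map_smul' t x := (Algebra.smul_def t (show R from x)).symm
  left_inv _ := rfl
  right_inv _ := rfl

/-- The `T`-linear equivalence underlying `extendScalarsEquiv`. -/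
def extendScalarsEquivAux (X : ModuleCat.{u} T) :
    TensorProduct T ((ModuleCat.restrictScalars (algebraMap T R)).obj (ModuleCat.of R R)) X ≃ₗ[T]
      R ⊗[T] X :=
  TensorProduct.congr (restrictScalarsEquiv T R) (LinearEquiv.refl T X)

/-- The extension of scalars of `ModuleCat` is the usual base change `R ⊗[T] X`. -/
def extendScalarsEquiv (X : ModuleCat.{u} T) :
    (ModuleCat.extendScalars.{u,u,u} (algebraMap T R)).obj X ≃ₗ[R] R ⊗[T] X where
  toFun := extendScalarsEquivAux T R X
  invFun := (extendScalarsEquivAux T R X).symm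
  map_add' := map_add (extendScalarsEquivAux T R X)
  map_smul' r x := by
    induction x using TensorProduct.induction_on with
    | zero =>
      change extendScalarsEquivAux T R X
        (r • (0 : (ModuleCat.extendScalars.{u,u,u} (algebraMap T R)).obj X)) =
          r • (extendScalarsEquivAux T R X) 0
      rw [smul_zero, map_zero, smul_zero]
      exact map_zero (extendScalarsEquivAux T R X)
    | tmul s m => rfl
    | add a b ha hb =>
      have h1 := congrArg₂ (· + ·) ha hb
      refine Eq.trans ?_ (h1.trans ?_)
      · refine Eq.trans (congrArg (extendScalarsEquivAux T R X) ?_)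
          (map_add (extendScalarsEquivAux T R X) _ _)
        exact smul_add (A := (ModuleCat.extendScalars.{u,u,u} (algebraMap T R)).obj X) r a b
      · exact ((smul_add r (extendScalarsEquivAux T R X a)
          (extendScalarsEquivAux T R X b)).symm.trans
          (congrArg (fun z : R ⊗[T] X => r • z) (map_add (extendScalarsEquivAux T R X) a b).symm))
  left_inv := (extendScalarsEquivAux T R X).left_inv
  right_inv := (extendScalarsEquivAux T R X).right_inv

theorem extendScalarsEquiv_map {X Y : ModuleCat.{u} T} (g : X ⟶ Y) (z) :
    extendScalarsEquiv T R Y ((ModuleCat.extendScalars.{u,u,u} (algebraMap T R)).map g z) =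
      g.hom.baseChange R (extendScalarsEquiv T R X z) := by
  induction z using TensorProduct.induction_on with
  | zero =>
    have : ((ModuleCat.extendScalars.{u,u,u} (algebraMap T R)).map g)
        (0 : (ModuleCat.extendScalars.{u,u,u} (algebraMap T R)).obj X) = 0 := map_zero _
    refine (congrArg (extendScalarsEquiv T R Y) this).trans ?_
    exact (map_zero (extendScalarsEquiv T R Y)).trans
      ((congrArg _ (map_zero (extendScalarsEquiv T R X))).trans (map_zero _)).symm
  | tmul s m => rfl
  | add a b ha hb =>
    exact (congrArg (extendScalarsEquiv T R Y)
      (map_add ((ModuleCat.extendScalars.{u,u,u} (algebraMap T R)).map g).hom a b)).trans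
        ((map_add (extendScalarsEquiv T R Y) _ _).trans ((congrArg₂ (· + ·) ha hb).trans (by
          rw [← map_add]
          exact congrArg _ (map_add (extendScalarsEquiv T R X) _ _).symm)))
end ExtendScalars

/-- The map `ψ` is a cokernel of `S.f`, so the homology `ker g / im f` is the image of `ker g` under
`ψ`, which is `N`. -/
theorem nonempty_homology_equiv {R : Type u} [CommRing R] (S : ShortComplex (ModuleCat.{u} R))
    {W : Type u} [AddCommGroup W] [Module R W] (ψ : S.X₂ →ₗ[R] W) (hψ : Function.Surjective ψ)
    (hf : ∀ x, ψ x = 0 ↔ ∃ y, S.f y = x) (N : Submodule R W) (hg : ∀ x, S.g x = 0 ↔ ψ x ∈ N) :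
    Nonempty (S.homology ≃ₗ[R] N) := by
  let φ : LinearMap.ker S.g.hom →ₗ[R] N :=
    (ψ.comp (LinearMap.ker S.g.hom).subtype).codRestrict N fun x => (hg x).1 x.2
  have hφ : Function.Surjective φ := fun ⟨w, hw⟩ => by
    obtain ⟨x, rfl⟩ := hψ w
    exact ⟨⟨x, (hg x).2 hw⟩, rfl⟩
  have hker : LinearMap.range S.moduleCatToCycles = LinearMap.ker φ := by
    ext x
    rw [LinearMap.mem_range, LinearMap.mem_ker, ← Subtype.coe_inj]
    refine Iff.trans ?_ (hf x).symm
    exact exists_congr fun y => Subtype.ext_iff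
  exact ⟨S.moduleCatHomologyIso.toLinearEquiv.trans
    ((Submodule.quotEquivOfEq _ _ hker).trans (φ.quotKerEquivOfSurjective hφ))⟩

/-- `Tor₁` is the kernel of `R ⊗ K → R ⊗ P` for a presentation `0 → K → P → M → 0` with `P`
projective. -/
theorem exists_torOne_equiv_ker (T R : Type u) [CommRing T] [CommRing R] [Algebra T R]
    (M : Type u) [AddCommGroup M] [Module T M] :
    ∃ (P : Type u) (_ : AddCommGroup P) (_ : Module T P) (g : P →ₗ[T] M), Module.Projective T P ∧
      Function.Surjective g ∧
      Nonempty (TorOne T R M ≃ₗ[R] LinearMap.ker ((LinearMap.ker g).subtype.baseChange R)) := by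
  let P := ProjectiveResolution.of (ModuleCat.of T M)
  let F := ModuleCat.extendScalars.{u, u, u} (algebraMap T R)
  let g : P.complex.X 0 →ₗ[T] M := (P.π.f 0).hom
  have hP : Module.Projective T (P.complex.X 0) :=
    (IsProjective.iff_projective _).2 (P.projective 0)
  have hg : Function.Surjective g := (ModuleCat.epi_iff_surjective (P.π.f 0)).1 inferInstance
  have h1 : ∀ x : P.complex.X 0, g x = 0 ↔ ∃ y, P.complex.d 1 0 y = x := fun x =>
    ⟨(ShortComplex.moduleCat_exact_iff _).1 P.exact₀ x, by
      rintro ⟨y, rfl⟩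
      exact ShortComplex.moduleCat_zero_apply (ShortComplex.mk _ _ P.complex_d_comp_π_f_zero) y⟩
  let δ : P.complex.X 1 →ₗ[T] LinearMap.ker g :=
    (P.complex.d 1 0).hom.codRestrict _ fun y => (h1 _).2 ⟨y, rfl⟩
  have hδ : Function.Surjective δ := fun ⟨x, hx⟩ => by
    obtain ⟨y, hy⟩ := (h1 x).1 hx
    exact ⟨y, Subtype.ext hy⟩
  have hex : Function.Exact (P.complex.d 2 1).hom δ := fun y => by
    rw [← Subtype.coe_inj]
    exact ⟨(ShortComplex.moduleCat_exact_iff _).1 (P.exact_succ 0) y, by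
      rintro ⟨y, rfl⟩
      exact ShortComplex.moduleCat_zero_apply
        (ShortComplex.mk _ _ (P.complex.d_comp_d 2 1 0)) y⟩
  -- By right exactness `R ⊗ ker g` is the cokernel of `R ⊗ P₂ → R ⊗ P₁`, so the first homology is
  -- the kernel of the induced map to `R ⊗ P₀`.
  have hexR := lTensor_exact R hex hδ
  let e := fun i => extendScalarsEquiv T R (P.complex.X i)
  let C := (F.mapHomologicalComplex (ComplexShape.down ℕ)).obj P.complex
  let ψ : (C.sc' 2 1 0).X₂ →ₗ[R] R ⊗[T] LinearMap.ker g := (δ.baseChange R).comp (e 1).toLinearMap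
  have hcomp : ∀ z, (LinearMap.ker g).subtype.baseChange R (δ.baseChange R z) =
      (P.complex.d 1 0).hom.baseChange R z := fun z => by
    rw [← LinearMap.comp_apply, ← LinearMap.baseChange_comp]
    rfl
  obtain ⟨E⟩ := nonempty_homology_equiv (C.sc' 2 1 0) ψ
    ((LinearMap.lTensor_surjective R hδ).comp (e 1).surjective) (fun x => by
      refine (hexR (e 1 x)).trans ⟨?_, ?_⟩
      · rintro ⟨y, hy⟩
        obtain ⟨z, rfl⟩ := (e 2).surjective y
        exact ⟨z, (e 1).injective ((extendScalarsEquiv_map T R (P.complex.d 2 1) z).trans hy)⟩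
      · rintro ⟨z, rfl⟩
        exact ⟨e 2 z, (extendScalarsEquiv_map T R (P.complex.d 2 1) z).symm⟩)
    (LinearMap.ker ((LinearMap.ker g).subtype.baseChange R)) (fun x => by
      have := (extendScalarsEquiv_map T R (P.complex.d 1 0) x).trans (hcomp (e 1 x)).symm
      refine Iff.trans ?_ (Iff.of_eq (congrArg (· = 0) this))
      exact ((e 0).map_eq_zero_iff).symm)
  exact ⟨P.complex.X 0, inferInstance, inferInstance, g, hP, hg,
    ⟨((P.isoLeftDerivedObj F 1).toLinearEquiv).trans
      ((C.homologyIsoSc' 2 1 0 (by simp) (by simp)).toLinearEquiv.trans E)⟩⟩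

/-! ### Finiteness, annihilators and localisation of `Tor₁` -/

section KernelBaseChange
variable {T : Type u} [CommRing T] {P M : Type u} [AddCommGroup P] [Module T P] [AddCommGroup M]
  [Module T M] {g : P →ₗ[T] M} (R : Type u) [CommRing R] [Algebra T R]

/-- The projective `P` may be infinitely generated, so its presentation is compared with a finite
free one: the kernel for `g` is the image of the kernel for `g'`, a submodule of a noetherian
module. -/
theorem finite_ker_baseChange_subtype_ker [IsNoetherianRing T] [IsNoetherianRing R]
    [Module.Projective T P] [Module.Finite T M] (hg : Function.Surjective g) :
    Module.Finite R (LinearMap.ker ((LinearMap.ker g).subtype.baseChange R)) := by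
  obtain ⟨k, g', hg'⟩ := Module.Finite.exists_fin' T M
  obtain ⟨α, hα⟩ := Module.projective_lifting_property g' g hg'
  obtain ⟨β, hβ⟩ := Module.projective_lifting_property g g' hg
  have hα' : ∀ x, g' (α x) = g x := fun x => LinearMap.congr_fun hα x
  have hβ' : ∀ x, g (β x) = g' x := fun x => LinearMap.congr_fun hβ x
  let a : LinearMap.ker g →ₗ[T] LinearMap.ker g' :=
    α.restrict fun x hx => by rw [LinearMap.mem_ker, hα']; exact hx
  let b : LinearMap.ker g' →ₗ[T] LinearMap.ker g :=
    β.restrict fun x hx => by rw [LinearMap.mem_ker, hβ']; exact hx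
  let h : P →ₗ[T] LinearMap.ker g :=
    (β ∘ₗ α - LinearMap.id).codRestrict _ fun x => by simp [hα', hβ']
  have h1 : (LinearMap.ker g').subtype ∘ₗ a = α ∘ₗ (LinearMap.ker g).subtype := rfl
  have h2 : (LinearMap.ker g).subtype ∘ₗ b = β ∘ₗ (LinearMap.ker g').subtype := rfl
  -- The homotopy `h` passes through the inclusion, so after base change `b ∘ a` is the identity on
  -- the kernel in question.
  have h3 : b ∘ₗ a = LinearMap.id + h ∘ₗ (LinearMap.ker g).subtype := by
    ext x
    simp [a, b, h]
  have h1' := congrArg (LinearMap.baseChange R) h1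
  have h2' := congrArg (LinearMap.baseChange R) h2
  have h3' := congrArg (LinearMap.baseChange R) h3
  simp only [LinearMap.baseChange_comp, LinearMap.baseChange_add, LinearMap.baseChange_id]
    at h1' h2' h3'
  have key : LinearMap.ker ((LinearMap.ker g).subtype.baseChange R) =
      (LinearMap.ker ((LinearMap.ker g').subtype.baseChange R)).map (b.baseChange R) := by
    ext z
    rw [Submodule.mem_map]
    constructor
    · intro hz
      rw [LinearMap.mem_ker] at hz
      refine ⟨a.baseChange R z, ?_, ?_⟩
      · have := LinearMap.congr_fun h1' z
        simp only [LinearMap.comp_apply] at this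
        rw [LinearMap.mem_ker, this, hz, map_zero]
      · have := LinearMap.congr_fun h3' z
        simpa [hz] using this
    · rintro ⟨y, hy, rfl⟩
      rw [LinearMap.mem_ker] at hy ⊢
      have := LinearMap.congr_fun h2' y
      simp only [LinearMap.comp_apply] at this
      rw [this, hy, map_zero]
  have : IsNoetherian R (R ⊗[T] LinearMap.ker g') := isNoetherian_of_isNoetherianRing_of_finite R _
  rw [key]
  exact Module.Finite.iff_fg.2 ((IsNoetherian.noetherian _).map _)

/-- As `s` kills `M`, multiplication by `s` maps `P` into `ker g`. On `ker g` it therefore factors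
through the inclusion, whose base change kills `z`. -/
theorem smul_ker_baseChange_subtype_ker {s : T} (hs : ∀ m : M, s • m = 0)
    (z : LinearMap.ker ((LinearMap.ker g).subtype.baseChange R)) : algebraMap T R s • z = 0 := by
  let h : P →ₗ[T] LinearMap.ker g := (LinearMap.lsmul T P s).codRestrict _ fun x => by simp [hs]
  have h1 : h ∘ₗ (LinearMap.ker g).subtype = s • LinearMap.id := by
    rfl
  have h2 := LinearMap.congr_fun (congrArg (LinearMap.baseChange R) h1) z.1
  rw [LinearMap.baseChange_comp, LinearMap.comp_apply, z.2, map_zero, LinearMap.baseChange_smul,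
    LinearMap.baseChange_id] at h2
  ext
  rw [Submodule.coe_smul, algebraMap_smul]
  exact h2.symm

end KernelBaseChange

theorem LinearMap.nonempty_ker_equiv {V : Type*} [CommRing V] {A B C D : Type*} [AddCommGroup A]
    [Module V A] [AddCommGroup B] [Module V B] [AddCommGroup C] [Module V C] [AddCommGroup D]
    [Module V D] (f : A →ₗ[V] B) (g : C →ₗ[V] D) (e : A ≃ₗ[V] C) (e' : B ≃ₗ[V] D)
    (h : ∀ x, g (e x) = e' (f x)) : Nonempty (LinearMap.ker f ≃ₗ[V] LinearMap.ker g) := by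
  have : LinearMap.ker f = (LinearMap.ker g).comap e.toLinearMap := by
    ext x
    simp [h]
  rw [this]
  exact ⟨e.ofSubmodule' _⟩

theorem LinearMap.length_ker_baseChange_baseChange {T S V : Type*} [CommRing T] [CommRing S]
    [CommRing V] [Algebra T S] [Algebra S V] [Algebra T V] [IsScalarTower T S V] {K P : Type*}
    [AddCommGroup K] [Module T K] [AddCommGroup P] [Module T P] (f : K →ₗ[T] P) :
    Module.length V (LinearMap.ker ((f.baseChange S).baseChange V)) =
      Module.length V (LinearMap.ker (f.baseChange V)) := by
  obtain ⟨e⟩ := LinearMap.nonempty_ker_equiv ((f.baseChange S).baseChange V) (f.baseChange V)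
    (TensorProduct.AlgebraTensorModule.cancelBaseChange T S V V K)
    (TensorProduct.AlgebraTensorModule.cancelBaseChange T S V V P) (fun x => by
      induction x using TensorProduct.induction_on with
      | zero => simp
      | add a b ha hb => simp only [map_add, ha, hb]
      | tmul v y =>
        induction y using TensorProduct.induction_on with
        | zero => simp
        | add a b ha hb => simp only [TensorProduct.tmul_add, map_add, ha, hb]
        | tmul s k => simp)
  exact e.length_eq

theorem LinearMap.length_tensorProduct_ker {R V : Type*} [CommRing R] [CommRing V] [Algebra R V]
    [Module.Flat R V] {K P : Type*} [AddCommGroup K] [Module R K] [AddCommGroup P] [Module R P]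
    (f : K →ₗ[R] P) :
    Module.length V (V ⊗[R] LinearMap.ker f) = Module.length V (LinearMap.ker (f.baseChange V)) :=
  (LinearMap.tensorKerEquiv V V f).length_eq

/-- Here `J` stands for `K/πK → P/πP`. With `D = {x ∈ P : π x ∈ j K}`, both `ker J` (via `x ↦ j⁻¹(π
x)`) and `N[π]` (via `q`) are the quotient `D / j K`. -/
theorem length_ker_eq_length_ker_lsmul {S V : Type u} [CommRing S] [CommRing V]
    [Algebra S V] {π : S} (hV : Function.Surjective (algebraMap S V))
    {K P N : Type u} [AddCommGroup K] [Module S K] [AddCommGroup P] [Module S P] [AddCommGroup N]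
    [Module S N] {j : K →ₗ[S] P} {q : P →ₗ[S] N} (hj : Function.Injective j)
    (hq : Function.Surjective q) (hjq : Function.Exact j q) (hπ : ∀ x y : P, π • x = π • y → x = y)
    {A B : Type u} [AddCommGroup A] [Module V A] [Module S A] [IsScalarTower S V A]
    [AddCommGroup B] [Module V B] [Module S B] [IsScalarTower S V B] (J : A →ₗ[V] B)
    {a : K →ₗ[S] A} (ha : Function.Surjective a) (ha0 : ∀ v, a v = 0 ↔ ∃ w, v = π • w)
    {b : P →ₗ[S] B} (hb0 : ∀ v, b v = 0 ↔ ∃ w, v = π • w) (hJ : ∀ v, J (a v) = b (j v)) :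
    Module.length V (LinearMap.ker J) =
      Module.length S (LinearMap.ker (LinearMap.lsmul S N π)) := by
  let e := LinearEquiv.ofInjective j hj
  let D : Submodule S P := (LinearMap.range j).comap (LinearMap.lsmul S P π)
  let φ : D →ₗ[S] K := e.symm.toLinearMap ∘ₗ (LinearMap.lsmul S P π).restrict (fun x hx => hx)
  have hφ : ∀ x : D, j (φ x) = π • (x : P) := fun x =>
    congrArg Subtype.val (e.apply_symm_apply _)
  let α : D →ₗ[S] (LinearMap.ker J).restrictScalars S :=
    LinearMap.codRestrict _ (a ∘ₗ φ) fun x => by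
      rw [Submodule.restrictScalars_mem, LinearMap.mem_ker, LinearMap.comp_apply, hJ, hφ, hb0]
      exact ⟨x, rfl⟩
  have hα : ∀ x, α x = 0 ↔ (x : P) ∈ LinearMap.range j := fun x => by
    rw [← Subtype.coe_inj]
    refine (ha0 (φ x)).trans ⟨?_, ?_⟩
    · rintro ⟨w, hw⟩
      exact ⟨w, hπ _ _ (by rw [← hφ, hw, map_smul])⟩
    · rintro ⟨w, hw⟩
      exact ⟨w, hj (by rw [hφ, map_smul, hw])⟩
  have hαs : Function.Surjective α := by
    rintro ⟨w, hw⟩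
    obtain ⟨k, rfl⟩ := ha w
    rw [Submodule.restrictScalars_mem, LinearMap.mem_ker, hJ, hb0] at hw
    obtain ⟨x, hx⟩ := hw
    have hxA : x ∈ D := ⟨k, hx⟩
    refine ⟨⟨x, hxA⟩, Subtype.ext ?_⟩
    change a (φ ⟨x, hxA⟩) = a k
    rw [hj ((hφ ⟨x, hxA⟩).trans hx.symm)]
  let β : D →ₗ[S] LinearMap.ker (LinearMap.lsmul S N π) := q.restrict fun x hx => by
    rw [LinearMap.mem_ker, LinearMap.lsmul_apply, ← map_smul]
    exact (hjq _).2 hx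
  have hβ : ∀ x, β x = 0 ↔ (x : P) ∈ LinearMap.range j := fun x => by
    rw [← Subtype.coe_inj]
    exact hjq _
  have hβs : Function.Surjective β := by
    rintro ⟨w, hw⟩
    obtain ⟨x, rfl⟩ := hq w
    rw [LinearMap.mem_ker, LinearMap.lsmul_apply, ← map_smul] at hw
    exact ⟨⟨x, (hjq _).1 hw⟩, rfl⟩
  have hk : LinearMap.ker α = LinearMap.ker β :=
    Submodule.ext fun x => by rw [LinearMap.mem_ker, LinearMap.mem_ker, hα, hβ]
  have l1 := (α.quotKerEquivOfSurjective hαs).length_eq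
  have l2 := (β.quotKerEquivOfSurjective hβs).length_eq
  rw [← l2, ← hk, l1]
  exact (Module.length_eq_of_surjective (M := LinearMap.ker J) hV).symm

/-- For `K = ker g`, the kernel of `V ⊗ K → V ⊗ P` can be reached through `R`, where flatness of `R
→ V` gives `V ⊗ Tor₁`, or through `S`, where flatness of `T → S` keeps the presentation exact and `V
= S/π` gives the `π`-torsion. -/
theorem length_tensorProduct_torOne {T R S V : Type u} [CommRing T] [CommRing R] [CommRing S]
    [IsDomain S] [CommRing V] [Algebra T R] [Algebra T S] [Algebra S V] [Algebra R V] [Algebra T V]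
    [IsScalarTower T R V] [IsScalarTower T S V] [Module.Flat R V] [Module.Flat T S] {π : S}
    (hπ : π ≠ 0) (hV : Function.Surjective (algebraMap S V))
    (hker : RingHom.ker (algebraMap S V) = Ideal.span {π}) (M : Type u) [AddCommGroup M]
    [Module T M] :
    Module.length V (V ⊗[R] TorOne T R M) =
      Module.length S (LinearMap.ker (LinearMap.lsmul S (S ⊗[T] M) π)) := by
  obtain ⟨P, _, _, g, hP, hg, ⟨e⟩⟩ := exists_torOne_equiv_ker T R M
  have hπ' : ∀ x y : S ⊗[T] P, π • x = π • y → x = y := fun _ _ h =>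
    Module.Flat.isSMulRegular_of_nonZeroDivisors (mem_nonZeroDivisors_of_ne_zero hπ) h
  rw [(e.baseChange R V _ _).length_eq, LinearMap.length_tensorProduct_ker,
    LinearMap.length_ker_baseChange_baseChange,
    ← LinearMap.length_ker_baseChange_baseChange (S := S)]
  have hmem : ∀ {L : Type u} [AddCommGroup L] [Module S L] (v : L),
      (1 : V) ⊗ₜ[S] v = 0 ↔ ∃ w, v = π • w := fun v => by
    rw [one_tmul_eq_zero_iff_mem_ker_smul_top hV, hker, Submodule.ideal_span_singleton_smul,
      Submodule.mem_smul_pointwise_iff_exists]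
    simp [eq_comm]
  exact length_ker_eq_length_ker_lsmul hV
    (j := (LinearMap.ker g).subtype.baseChange S) (q := g.baseChange S)
    (Module.Flat.lTensor_preserves_injective_linearMap _ (Submodule.subtype_injective _))
    (LinearMap.lTensor_surjective S hg)
    (lTensor_exact S (LinearMap.exact_subtype_ker_map g) hg) hπ' _
    (a := TensorProduct.mk S V _ 1) (TensorProduct.mk_surjective S _ V hV) hmem
    (b := TensorProduct.mk S V _ 1) hmem fun v => LinearMap.baseChange_tmul _ _ _

theorem finite_torOne (T R : Type u) [CommRing T] [IsNoetherianRing T] [CommRing R]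
    [IsNoetherianRing R] [Algebra T R] (M : Type u) [AddCommGroup M] [Module T M]
    [Module.Finite T M] : Module.Finite R (TorOne T R M) := by
  obtain ⟨P, _, _, g, hP, hg, ⟨e⟩⟩ := exists_torOne_equiv_ker T R M
  have := finite_ker_baseChange_subtype_ker R hg
  exact Module.Finite.equiv e.symm

theorem smul_torOne_eq_zero {T R : Type u} [CommRing T] [CommRing R] [Algebra T R] {M : Type u}
    [AddCommGroup M] [Module T M] {s : T} (hs : ∀ m : M, s • m = 0) (z : TorOne T R M) :
    algebraMap T R s • z = 0 := by
  obtain ⟨P, _, _, g, hP, hg, ⟨e⟩⟩ := exists_torOne_equiv_ker T R M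
  apply e.injective
  rw [map_smul, map_zero]
  exact smul_ker_baseChange_subtype_ker R hs _

/-! ### Normality of power series rings -/

section PowerSeriesNormal

open PowerSeries

/-- If `r = X^m s` with `s(0) ≠ 0` is a common denominator for the powers of `X^i g`, the
coefficient in degree `m + i n` shows `s(0) g(0)^n ∈ B`. -/
theorem IsAlmostIntegral.constantCoeff_of_X_pow_mul {B K : Type*} [CommRing B] [IsDomain B]
    [Field K] [Algebra B K] {i : ℕ} {g : K⟦X⟧}
    (h : IsAlmostIntegral B⟦X⟧ (X ^ i * g)) : IsAlmostIntegral B (constantCoeff g) := by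
  obtain ⟨r, hr, hr'⟩ := h
  have hr0 : r ≠ 0 := nonZeroDivisors.ne_zero hr
  obtain ⟨m, s, hs, hrs⟩ : ∃ (m : ℕ) (s : B⟦X⟧), constantCoeff s ≠ 0 ∧ r = X ^ m * s := by
    refine ⟨r.order.toNat, divXPowOrder r, ?_, (X_pow_order_mul_divXPowOrder).symm⟩
    rw [constantCoeff_divXPowOrder]
    exact coeff_order hr0
  refine ⟨constantCoeff s, mem_nonZeroDivisors_of_ne_zero hs, fun n => ?_⟩
  obtain ⟨y, hy⟩ := hr' n
  refine ⟨PowerSeries.coeff (m + i * n) y, ?_⟩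
  have h1 : algebraMap B⟦X⟧ K⟦X⟧ y = X ^ (m + i * n) * (map (algebraMap B K) s * g ^ n) := by
    rw [hy, hrs, Algebra.smul_def, map_mul, map_pow]
    change map (algebraMap B K) X ^ m * map (algebraMap B K) s * _ = _
    rw [map_X]
    ring
  have h2 : PowerSeries.coeff (m + i * n) (algebraMap B⟦X⟧ K⟦X⟧ y) =
      algebraMap B K (PowerSeries.coeff (m + i * n) y) :=
    coeff_map _ _ _
  rw [← h2, h1, coeff_X_pow_mul', if_pos le_rfl, Nat.sub_self, coeff_zero_eq_constantCoeff,
    map_mul, map_pow, Algebra.smul_def, ← coeff_zero_eq_constantCoeff_apply, coeff_map,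
    coeff_zero_eq_constantCoeff_apply]

/-- Induction on the degree: once the coefficients below `i` lie in `B`, subtracting the truncation
leaves an almost integral `X^i g` with `g(0)` the next coefficient. -/
theorem IsAlmostIntegral.mem_range_powerSeries {B K : Type*} [CommRing B] [IsDomain B]
    [Field K] [Algebra B K] (hB : ∀ x : K, IsAlmostIntegral B x → x ∈ (algebraMap B K).range)
    {c : K⟦X⟧} (hc : IsAlmostIntegral B⟦X⟧ c) : c ∈ (algebraMap B⟦X⟧ K⟦X⟧).range := by
  have key : ∀ i, PowerSeries.coeff i c ∈ (algebraMap B K).range := by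
    intro i
    induction i using Nat.strong_induction_on with
    | h i ih =>
      choose! b hb using ih
      have ht : (c.trunc i : K⟦X⟧) = algebraMap B⟦X⟧ K⟦X⟧ (mk fun j => if j < i then b j else 0) := by
        ext j
        change _ = PowerSeries.coeff j (map _ _)
        rw [Polynomial.coeff_coe, coeff_trunc, coeff_map, coeff_mk]
        split_ifs with hj
        · exact (hb j hj).symm
        · simp
      have h1 : IsAlmostIntegral B⟦X⟧ (X ^ i * mk fun k => PowerSeries.coeff (k + i) c) := by
        rw [← mem_completeIntegralClosure] at hc ⊢
        have h2 := eq_X_pow_mul_shift_add_trunc i c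
        rw [← sub_eq_iff_eq_add] at h2
        rw [← h2, ht]
        exact sub_mem hc (algebraMap_mem _ _)
      have h3 := hB _ h1.constantCoeff_of_X_pow_mul
      rwa [← coeff_zero_eq_constantCoeff_apply, coeff_mk, zero_add] at h3
  choose b hb using key
  exact ⟨mk b, PowerSeries.ext fun j =>
    (coeff_map _ _ _).trans ((congrArg _ (coeff_mk _ _)).trans (hb j))⟩

/-- An integral fraction lies in `K⟦X⟧`, which is integrally closed. Almost integrality, which is a
common denominator for all powers, then passes to coefficients, and over the noetherian ring `B` it
is integrality again. -/
theorem isIntegrallyClosed_powerSeries (B : Type*) [CommRing B] [IsDomain B] [IsNoetherianRing B]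
    [IsIntegrallyClosed B] : IsIntegrallyClosed B⟦X⟧ := by
  let K := FractionRing B
  let F := FractionRing B⟦X⟧
  let L := FractionRing K⟦X⟧
  have hinj : Function.Injective (algebraMap B⟦X⟧ K⟦X⟧) :=
    PowerSeries.map_injective (algebraMap B K) (IsFractionRing.injective B K)
  have hL : Function.Injective (algebraMap K⟦X⟧ L) := IsFractionRing.injective _ _
  have hBL : Function.Injective (algebraMap B⟦X⟧ L) := by
    rw [IsScalarTower.algebraMap_eq B⟦X⟧ K⟦X⟧ L]
    exact hL.comp hinj
  let φ : F →ₐ[B⟦X⟧] L := IsFractionRing.liftAlgHom (g := Algebra.ofId B⟦X⟧ L) hBL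
  refine (isIntegrallyClosed_iff F).2 fun {x} hx => ?_
  obtain ⟨c, hc⟩ := (isIntegrallyClosed_iff L).1 inferInstance ((hx.map φ).tower_top (A := K⟦X⟧))
  obtain ⟨r, hr, hr'⟩ := hx.isAlmostIntegral
  have hca : IsAlmostIntegral B⟦X⟧ c := by
    refine ⟨r, hr, fun n => ?_⟩
    obtain ⟨y, hy⟩ := hr' n
    refine ⟨y, hL ?_⟩
    have := congrArg φ hy
    rw [AlgHom.commutes, map_smul, map_pow, ← hc, ← map_pow] at this
    rw [← IsScalarTower.algebraMap_apply, this, Algebra.smul_def, Algebra.smul_def, map_mul,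
      ← IsScalarTower.algebraMap_apply]
  obtain ⟨d, hd⟩ := hca.mem_range_powerSeries fun x hx => by
    obtain ⟨y, hy⟩ := (isIntegrallyClosed_iff K).1 inferInstance hx.isIntegral
    exact ⟨y, hy⟩
  refine ⟨d, φ.toRingHom.injective (Eq.trans (φ.commutes d) (Eq.trans ?_ hc))⟩
  rw [← hd, ← IsScalarTower.algebraMap_apply]

end PowerSeriesNormal

/-! ### Coheight of height one primes in power series rings -/

section HeightOneDimension

theorem mem_colon_bot_mk_iff_dvd_mul {A : Type*} [CommRing A] (f y z : A) :
    y ∈ (⊥ : Submodule A (A ⧸ Ideal.span {f})).colon {Ideal.Quotient.mk (Ideal.span {f}) z} ↔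
      f ∣ y * z := by
  rw [Submodule.mem_colon_singleton, Submodule.mem_bot, ← Ideal.Quotient.eq_zero_iff_dvd, map_mul]
  rfl

theorem exists_mem_iff_dvd_mul_of_mem_minimalPrimes {A : Type*} [CommRing A] [IsNoetherianRing A]
    {p : Ideal A} {f : A} (hp : p ∈ (Ideal.span {f}).minimalPrimes) :
    ∃ u, ∀ x, x ∈ p ↔ f ∣ x * u := by
  have h := Module.associatedPrimes.minimalPrimes_annihilator_subset_associatedPrimes A
    (A ⧸ Ideal.span {f}) (by rwa [Ideal.annihilator_quotient])
  obtain ⟨-, w, hw⟩ := isAssociatedPrime_iff.mp h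
  obtain ⟨u, rfl⟩ := Ideal.Quotient.mk_surjective w
  exact ⟨u, fun x => by rw [hw, mem_colon_bot_mk_iff_dvd_mul]⟩

theorem exists_isPrime_mem_iff_dvd_mul {A : Type*} [CommRing A] [IsNoetherianRing A] {f v : A}
    (hfv : ¬ f ∣ v) :
    ∃ (p : Ideal A) (u : A), p.IsPrime ∧ (∀ x, x ∈ p ↔ f ∣ x * u) ∧ ∀ x, f ∣ x * v → x ∈ p := by
  obtain ⟨p, hp, hle⟩ := exists_le_isAssociatedPrime_of_isNoetherianRing A
    (Ideal.Quotient.mk (Ideal.span {f}) v) (by rwa [Ne, Ideal.Quotient.eq_zero_iff_dvd])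
  obtain ⟨hprime, w, hw⟩ := isAssociatedPrime_iff.mp hp
  obtain ⟨u, rfl⟩ := Ideal.Quotient.mk_surjective w
  exact ⟨p, u, hprime, fun x => by rw [hw, mem_colon_bot_mk_iff_dvd_mul],
    fun x hx => hle ((mem_colon_bot_mk_iff_dvd_mul f x v).2 hx)⟩

theorem Ideal.eq_of_le_of_height_eq_one {A : Type*} [CommRing A] [IsDomain A] {p q : Ideal A}
    [p.IsPrime] [q.IsPrime] (hpq : p ≤ q) (hp : p ≠ ⊥) (hq : q.height = 1) : p = q := by
  by_contra h
  have : q.FiniteHeight := ⟨Or.inr (by rw [hq]; exact ENat.one_ne_top)⟩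
  have h1 := Ideal.height_strict_mono_of_isPrime_of_isPrime (lt_of_le_of_ne hpq h)
  rw [hq, Order.lt_one_iff, Ideal.height_eq_zero_iff, IsDomain.minimalPrimes_eq_singleton_bot] at h1
  exact hp h1

theorem Ideal.mem_minimalPrimes_span_singleton_of_height_eq_one {A : Type*} [CommRing A]
    [IsDomain A] {p : Ideal A} [p.IsPrime] (hp : p.height = 1) {f : A} (hf : f ∈ p) (hf0 : f ≠ 0) :
    p ∈ (Ideal.span {f}).minimalPrimes := by
  refine ⟨⟨inferInstance, by rwa [Ideal.span_singleton_le_iff_mem]⟩, fun q ⟨hq, hfq⟩ hqp => ?_⟩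
  refine (Ideal.eq_of_le_of_height_eq_one hqp ?_ hp).ge
  rintro rfl
  exact hf0 (by simpa using hfq)

open PowerSeries in
/-- If the height one primes of a normal local domain `B` have coheight at least `d`, those of
`B⟦X⟧` have coheight at least `d + 1`. -/
theorem PowerSeries.le_ringKrullDim_quotient_of_height_eq_one {B : Type*} [CommRing B] [IsDomain B]
    [IsNoetherianRing B] [IsLocalRing B] [IsIntegrallyClosed B] {d : ℕ}
    (hd : d + 1 ≤ ringKrullDim B)
    (hB : ∀ (p : Ideal B) [p.IsPrime], p.height = 1 → d ≤ ringKrullDim (B ⧸ p))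
    (p : Ideal B⟦X⟧) [p.IsPrime] (hp : p.height = 1) : d + 1 ≤ ringKrullDim (B⟦X⟧ ⧸ p) := by
  have hXprime : Prime (X : B⟦X⟧) := X_prime
  have hcs : Function.Surjective (constantCoeff (R := B)) := constantCoeff_surj
  by_cases hXp : (X : B⟦X⟧) ∈ p
  · have : (Ideal.span {(X : B⟦X⟧)}).IsPrime := by
      rwa [Ideal.span_singleton_prime hXprime.ne_zero]
    have hpX := Ideal.eq_of_le_of_height_eq_one ((Ideal.span_singleton_le_iff_mem p).2 hXp)
      (by simp) hp
    refine hd.trans (ringKrullDim_le_of_surjective (Ideal.Quotient.lift p constantCoeff ?_)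
      (Ideal.Quotient.lift_surjective_of_surjective _ _ hcs))
    intro a ha
    rwa [← hpX, Ideal.mem_span_singleton, X_dvd_iff] at ha
  -- As `X ∉ p`, powers of `X` can be divided out of an element of `p`.
  obtain ⟨f, hf, hf0, hfX⟩ : ∃ f ∈ p, f ≠ 0 ∧ constantCoeff f ≠ 0 := by
    obtain ⟨g, hg, hg0⟩ := Submodule.exists_mem_ne_zero_of_ne_bot (Ideal.ne_bot_of_height_eq_one hp)
    have h1 : X ^ g.order.toNat * divXPowOrder g = g := X_pow_order_mul_divXPowOrder
    have h2 : constantCoeff (divXPowOrder g) ≠ 0 := by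
      rw [constantCoeff_divXPowOrder]
      exact coeff_order hg0
    refine ⟨divXPowOrder g, ?_, fun h => h2 (by rw [h, map_zero]), h2⟩
    rw [← h1] at hg
    exact ((Ideal.IsPrime.mem_or_mem ‹_› hg).resolve_left
      fun h => hXp (Ideal.IsPrime.mem_of_pow_mem ‹_› _ h))
  obtain ⟨u, hu⟩ := exists_mem_iff_dvd_mul_of_mem_minimalPrimes
    (Ideal.mem_minimalPrimes_span_singleton_of_height_eq_one hp hf hf0)
  have hfu : ¬ f ∣ u := fun h => Ideal.IsPrime.ne_top ‹_›
    ((Ideal.eq_top_iff_one p).2 ((hu 1).2 (by rwa [one_mul])))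
  let J : Ideal B⟦X⟧ := Submodule.colon (Ideal.span {f}) (p : Set B⟦X⟧)
  have hJ : ∀ v, v ∈ J ↔ ∀ x ∈ p, f ∣ v * x := fun v => by
    rw [Submodule.mem_colon]
    exact forall₂_congr fun x _ => Ideal.mem_span_singleton
  have hXf : ∀ y, f ∣ X * y → f ∣ y := by
    rintro y ⟨z, hz⟩
    rcases hXprime.dvd_or_dvd (Dvd.intro y hz) with h | ⟨w, rfl⟩
    · exact absurd (X_dvd_iff.1 h) hfX
    · exact ⟨w, mul_left_cancel₀ hXprime.ne_zero (by rw [hz]; ring)⟩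
  -- Otherwise each `v ∈ J` is `f c + X w`, with `w ∈ J` because `X` is regular modulo `f`. Nakayama
  -- then gives `J ⊆ (f)`, contradicting `u ∈ J`, `f ∤ u`.
  obtain ⟨v, hv, hvf⟩ : ∃ v ∈ J, ¬ constantCoeff f ∣ constantCoeff v := by
    by_contra! hcon
    have hle : J ≤ Ideal.span {f} := by
      refine Submodule.le_of_le_smul_of_le_jacobson_bot (I := maximalIdeal B⟦X⟧)
        (IsNoetherian.noetherian J) ?_ ?_
      · rw [IsLocalRing.jacobson_eq_maximalIdeal _ bot_ne_top]
      · intro v hv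
        obtain ⟨c, hc⟩ := hcon v hv
        obtain ⟨w, hw⟩ : X ∣ v - f * C c := by
          rw [X_dvd_iff, map_sub, map_mul, constantCoeff_C, hc, sub_self]
        have hwJ : w ∈ J := (hJ w).2 fun x hx => hXf _ (by
          rw [← mul_assoc, ← hw, sub_mul]
          exact dvd_sub ((hJ v).1 hv x hx) (by rw [mul_assoc]; exact dvd_mul_right _ _))
        rw [show v = f * C c + X * w by rw [← hw]; ring]
        refine Submodule.add_mem_sup (Ideal.mem_span_singleton.2 (dvd_mul_right _ _))
          (Submodule.smul_mem_smul ?_ hwJ)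
        rw [mem_maximalIdeal, mem_nonunits_iff, isUnit_iff_constantCoeff, constantCoeff_X]
        exact not_isUnit_zero
    exact hfu (Ideal.mem_span_singleton.1 (hle ((hJ u).2 fun x hx => by
      rw [mul_comm]; exact (hu x).1 hx)))
  -- From `v p ⊆ (f)`, the constant terms of `p` lie in `(f(0) : v(0))`, hence in an associated
  -- prime `p'` of `B/f(0)`, of height one by `S₂`. So `B⟦X⟧/p` maps onto `B/p'` and kills the
  -- nonzero class of `X`, which costs one dimension.
  obtain ⟨p', w, hp', hw, hle⟩ := exists_isPrime_mem_iff_dvd_mul hvf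
  have hht := height_eq_one_of_mem_iff_dvd_mul hfX hw
  let φ : B⟦X⟧ →+* B ⧸ p' := (Ideal.Quotient.mk p').comp constantCoeff
  have hφ : ∀ a ∈ p, φ a = 0 := fun a ha => by
    rw [RingHom.comp_apply, Ideal.Quotient.eq_zero_iff_mem]
    refine hle _ ?_
    rw [← map_mul, mul_comm]
    exact map_dvd constantCoeff ((hJ v).1 hv a ha)
  refine (add_le_add_left (hB p' hht) 1).trans
    (ringKrullDim_succ_le_of_surjective (Ideal.Quotient.lift p φ hφ)
      (Ideal.Quotient.lift_surjective_of_surjective _ _ (Ideal.Quotient.mk_surjective.comp hcs))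
      (r := Ideal.Quotient.mk p X) ?_ ?_)
  · exact mem_nonZeroDivisors_of_ne_zero (by rwa [Ne, Ideal.Quotient.eq_zero_iff_mem])
  · rw [Ideal.Quotient.lift_mk, RingHom.comp_apply, constantCoeff_X, map_zero]

theorem ringKrullDim_powerSeries {B : Type*} [CommRing B] [IsDomain B] [IsNoetherianRing B]
    [IsLocalRing B] : ringKrullDim (PowerSeries B) = ringKrullDim B + 1 := by
  rw [← ringKrullDim_quotient_span_singleton_succ_eq_ringKrullDim_of_mem_nonZeroDivisors
    (x := (PowerSeries.X : PowerSeries B))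
    (mem_nonZeroDivisors_of_ne_zero PowerSeries.X_prime.ne_zero) ?_]
  · congr 1
    refine ringKrullDim_eq_of_ringEquiv ((Ideal.quotEquivOfEq ?_).trans
      (RingHom.quotientKerEquivOfSurjective (f := PowerSeries.constantCoeff (R := B))
        PowerSeries.constantCoeff_surj))
    ext x
    rw [Ideal.mem_span_singleton, PowerSeries.X_dvd_iff, RingHom.mem_ker]
  · rw [mem_maximalIdeal, mem_nonunits_iff, PowerSeries.isUnit_iff_constantCoeff,
      PowerSeries.constantCoeff_X]
    exact not_isUnit_zero

theorem le_ringKrullDim_quotient_of_ringEquiv {A B : Type*} [CommRing A] [CommRing B] (e : A ≃+* B)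
    {d : WithBot ℕ∞} (h : ∀ (p : Ideal B) [p.IsPrime], p.height = 1 → d ≤ ringKrullDim (B ⧸ p))
    (p : Ideal A) [p.IsPrime] (hp : p.height = 1) : d ≤ ringKrullDim (A ⧸ p) := by
  have : (p.comap e.symm).IsPrime := Ideal.comap_isPrime _ _
  refine (h (p.comap e.symm) (by rw [RingEquiv.height_comap, hp])).trans (le_of_eq ?_)
  refine (ringKrullDim_eq_of_ringEquiv (Ideal.quotientEquiv p _ e ?_)).symm
  exact (Ideal.map_comap_of_equiv e).symm

/-- One induction carries all three facts, since the coheight bound for `n + 1` variables uses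
normality and dimension for `n`. -/
theorem MvPowerSeries.isIntegrallyClosed_and_ringKrullDim {O : Type*} [CommRing O] [IsDomain O]
    [IsDiscreteValuationRing O] (n : ℕ) :
    IsIntegrallyClosed (MvPowerSeries (Fin n) O) ∧ ringKrullDim (MvPowerSeries (Fin n) O) = n + 1 ∧
      ∀ (p : Ideal (MvPowerSeries (Fin n) O)) [p.IsPrime], p.height = 1 →
        n ≤ ringKrullDim (MvPowerSeries (Fin n) O ⧸ p) := by
  induction n with
  | zero =>
    let e : MvPowerSeries (Fin 0) O ≃+* O := (MvPowerSeries.isEmptyEquiv (σ := Fin 0) (R := O)).toRingEquiv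
    refine ⟨IsIntegrallyClosed.of_equiv e.symm, ?_, fun p hp _ => ?_⟩
    · rw [ringKrullDim_eq_of_ringEquiv e, IsDiscreteValuationRing.ringKrullDim_eq_one]
      rfl
    · have := Ideal.Quotient.nontrivial_iff.2 hp.ne_top
      exact ringKrullDim_nonneg_of_nontrivial
  | succ n ih =>
    obtain ⟨h1, h2, h3⟩ := ih
    have : IsDomain (MvPowerSeries (Fin n) O) := NoZeroDivisors.to_isDomain _
    let e : MvPowerSeries (Fin (n + 1)) O ≃+* PowerSeries (MvPowerSeries (Fin n) O) :=
      (MvPowerSeries.finSuccEquiv O n).toRingEquiv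
    have := isIntegrallyClosed_powerSeries (MvPowerSeries (Fin n) O)
    refine ⟨IsIntegrallyClosed.of_equiv e.symm, ?_, ?_⟩
    · rw [ringKrullDim_eq_of_ringEquiv e, ringKrullDim_powerSeries, h2]
      rfl
    · refine le_ringKrullDim_quotient_of_ringEquiv e fun p _ hp => ?_
      exact PowerSeries.le_ringKrullDim_quotient_of_height_eq_one h2.ge h3 p hp

end HeightOneDimension

/-! ### Heights and dimensions in integral extensions -/

section IntegralDimension

theorem ringKrullDim_le_of_isIntegral {A B : Type*} [CommRing A] [CommRing B] {f : A →+* B}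
    (hf : f.IsIntegral) : ringKrullDim B ≤ ringKrullDim A := by
  algebraize [f]
  refine Order.krullDim_le_of_strictMono (PrimeSpectrum.comap (algebraMap A B)) fun p q hpq => ?_
  exact Ideal.IsIntegral.comap_lt_comap (R := A) (I := p.asIdeal) (J := q.asIdeal) hpq

theorem ringKrullDim_le_of_isIntegral_of_injective {A B : Type*} [CommRing A] [CommRing B]
    {f : A →+* B} (hf : f.IsIntegral) (hinj : Function.Injective f) :
    ringKrullDim A ≤ ringKrullDim B := by
  algebraize [f]
  refine iSup_le fun l => ?_
  obtain ⟨Q, -, hQ, hl⟩ := Ideal.exists_ideal_over_prime_of_isIntegral (S := B) l.head.asIdeal ⊥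
    (by
      rw [← RingHom.ker_eq_comap_bot, (RingHom.injective_iff_ker_eq_bot (algebraMap A B)).1 hinj]
      exact bot_le)
  have : Q.LiesOver l.head.asIdeal := ⟨hl.symm⟩
  obtain ⟨L, hL, -⟩ := Ideal.exists_ltSeries_of_hasGoingUp l Q
  rw [← hL]
  exact le_iSup (fun L : LTSeries (PrimeSpectrum B) => (L.length : WithBot ℕ∞)) L

theorem Ideal.height_add_ringKrullDim_quotient_le {A : Type*} [CommRing A] (p : Ideal A)
    [p.IsPrime] : p.height + ringKrullDim (A ⧸ p) ≤ ringKrullDim A := by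
  let P : PrimeSpectrum A := ⟨p, inferInstance⟩
  have : Nonempty (PrimeSpectrum A) := ⟨P⟩
  have h1 : ringKrullDim (A ⧸ p) = Order.coheight P := by
    rw [ringKrullDim_quotient, Order.coheight_eq_krullDim_Ici]
    rfl
  have h2 : p.height = Order.height P := PrimeSpectrum.height_eq_orderHeight P
  rw [h1, h2, ringKrullDim, Order.krullDim_eq_iSup_height_add_coheight_of_nonempty]
  exact WithBot.coe_le_coe.2 (le_iSup (fun a : PrimeSpectrum A => Order.height a + Order.coheight a) P)

/-- Going down over the normal domain `A` bounds the height by one; incomparability excludes zero.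
-/
theorem Ideal.height_comap_eq_one_of_isIntegral {A R : Type*} [CommRing A] [IsDomain A]
    [IsNoetherianRing A] [IsIntegrallyClosed A] [CommRing R] [IsDomain R] [IsNoetherianRing R]
    [Algebra A R] [Algebra.IsIntegral A R] [FaithfulSMul A R] {q : Ideal R} [q.IsPrime]
    (hq : q.height = 1) : (q.comap (algebraMap A R)).height = 1 := by
  have h1 := Ideal.height_eq_height_add_of_liesOver_of_hasGoingDown (q.under A) q
  have h2 : (q.under A).height ≠ 0 := by
    rw [Ne, Ideal.height_eq_zero_iff, IsDomain.minimalPrimes_eq_singleton_bot]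
    have h3 := Ideal.IsIntegral.comap_lt_comap (R := A)
      (bot_lt_iff_ne_bot.2 (Ideal.ne_bot_of_height_eq_one hq))
    exact (bot_le.trans_lt h3).ne'
  exact le_antisymm (by rw [← hq, h1]; exact le_self_add)
    (Order.one_le_iff_pos.2 (pos_iff_ne_zero.2 h2))

/-- The height is at least two since the contraction strictly contains the kernel. For the upper
bound, `n ≤ dim A/(q ∩ A) ≤ dim R/q ≤ dim T/(q ∩ T)`, and height plus coheight is at most `dim T ≤ n
+ 2`; no catenarity is needed. -/
theorem Ideal.height_comap_eq_two {A T R : Type*} [CommRing A] [IsDomain A] [IsNoetherianRing A]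
    [IsIntegrallyClosed A] {n : ℕ}
    (hA : ∀ (p : Ideal A) [p.IsPrime], p.height = 1 → n ≤ ringKrullDim (A ⧸ p))
    [CommRing T] [IsNoetherianRing T] (hT : ringKrullDim T ≤ n + 2)
    [CommRing R] [IsDomain R] [IsNoetherianRing R] [Algebra A R] [Algebra.IsIntegral A R]
    [FaithfulSMul A R] [Algebra T R] [Algebra.IsIntegral T R]
    (hker : (RingHom.ker (algebraMap T R)).height = 1) {q : Ideal R} [q.IsPrime]
    (hq : q.height = 1) : (q.comap (algebraMap T R)).height = 2 := by
  have hPQ := Ideal.IsIntegral.comap_lt_comap (R := T)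
    (bot_lt_iff_ne_bot.2 (Ideal.ne_bot_of_height_eq_one hq))
  rw [← RingHom.ker_eq_comap_bot] at hPQ
  have := RingHom.ker_isPrime (algebraMap T R)
  have hlt := Ideal.height_strict_mono_of_isPrime_of_isPrime hPQ
  rw [hker] at hlt
  have h1 := (hA _ (Ideal.height_comap_eq_one_of_isIntegral (A := A) hq)).trans
    (ringKrullDim_le_of_isIntegral_of_injective
      (f := Ideal.quotientMap q (algebraMap A R) le_rfl)
      (algebraMap_isIntegral_iff.2 ‹_›).quotient Ideal.quotientMap_injective)
  have h2 := h1.trans (ringKrullDim_le_of_isIntegral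
      (f := Ideal.quotientMap q (algebraMap T R) le_rfl)
      (algebraMap_isIntegral_iff.2 ‹_›).quotient)
  have h3 := (Ideal.height_add_ringKrullDim_quotient_le (q.comap (algebraMap T R))).trans hT
  have h4 := (add_le_add_right h2 _).trans h3
  generalize (q.comap (algebraMap T R)).height = e at *
  have h5 : e + n ≤ (n + 2 : ℕ) := by
    rw [← WithBot.coe_le_coe]
    exact h4
  have he : e ≠ ⊤ := by
    rintro rfl
    simp at h5
  lift e to ℕ using he
  norm_cast at *
  omega

end IntegralDimension

/-! ### Local lengths as lengths of base changes -/

section LocalLength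

theorem exists_smul_eq_zero_of_notMem_support {T : Type u} [CommRing T] {M : Type u}
    [AddCommGroup M] [Module T M] [Module.Finite T M] {p : PrimeSpectrum T}
    (hp : p ∉ Module.support T M) : ∃ t ∉ p.asIdeal, ∀ m : M, t • m = 0 := by
  rw [Module.mem_support_iff_of_finite, SetLike.not_le_iff_exists] at hp
  obtain ⟨t, ht, htp⟩ := hp
  exact ⟨t, htp, fun m => Module.mem_annihilator.1 ht m⟩

theorem length_tensorProduct_eq_of_algEquiv {T B B' : Type*} [CommRing T] [CommRing B]
    [CommRing B'] [Algebra T B] [Algebra T B'] (e : B ≃ₐ[T] B') (M : Type*) [AddCommGroup M]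
    [Module T M] : Module.length B (B ⊗[T] M) = Module.length B' (B' ⊗[T] M) := by
  let _ : Algebra B B' := e.toRingEquiv.toRingHom.toAlgebra
  have : IsScalarTower T B B' := IsScalarTower.of_algebraMap_eq fun t => (e.commutes t).symm
  let l : B ≃ₗ[B] B' :=
    { e with map_smul' := fun a b => (e.map_mul a b).trans (Algebra.smul_def a (e b)).symm }
  have h1 := (TensorProduct.AlgebraTensorModule.congr l (LinearEquiv.refl T M)).length_eq
  rw [h1]
  exact Module.length_eq_of_surjective e.surjective

theorem length_tensorProduct_tensorProduct {T S V : Type*} [CommRing T] [CommRing S]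
    [CommRing V] [Algebra T S] [Algebra S V] [Algebra T V] [IsScalarTower T S V] (M : Type*)
    [AddCommGroup M] [Module T M] :
    Module.length V (V ⊗[S] (S ⊗[T] M)) = Module.length V (V ⊗[T] M) :=
  (TensorProduct.AlgebraTensorModule.cancelBaseChange T S V V M).length_eq

theorem length_tensorProduct_localizedModule {T V : Type*} [CommRing T] (N : Submonoid T)
    [CommRing V] [Algebra (Localization N) V] [Algebra T V] [IsScalarTower T (Localization N) V]
    (M : Type*) [AddCommGroup M] [Module T M] :
    Module.length V (V ⊗[Localization N] LocalizedModule N M) = Module.length V (V ⊗[T] M) := by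
  rw [← length_tensorProduct_tensorProduct (S := Localization N) M]
  exact ((LocalizedModule.equivTensorProduct N M).baseChange (Localization N) V _ _).length_eq

theorem localLength_eq_length_tensorProduct {A : Type*} [CommRing A] (M : Type*) [AddCommGroup M]
    [Module A M] (p : PrimeSpectrum A) (B : Type*) [CommRing B] [Algebra A B]
    [IsLocalization.AtPrime B p.asIdeal] :
    localLength A M p = Module.length B (B ⊗[A] M) := by
  rw [localLength, (LocalizedModule.equivTensorProduct p.asIdeal.primeCompl M).length_eq]
  exact length_tensorProduct_eq_of_algEquiv
    (IsLocalization.algEquiv p.asIdeal.primeCompl (Localization.AtPrime p.asIdeal) B) M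

theorem length_tensorProduct_localization_atPrime {T : Type*} [CommRing T] (N : Submonoid T)
    (p : Ideal (Localization N)) [p.IsPrime] (M : Type*) [AddCommGroup M] [Module T M] :
    Module.length (Localization.AtPrime p) (Localization.AtPrime p ⊗[T] M) =
      localLength T M ⟨p.comap (algebraMap T (Localization N)), inferInstance⟩ := by
  have := IsLocalization.isLocalization_isLocalization_atPrime_isLocalization N
    (Localization.AtPrime p) p
  rw [localLength_eq_length_tensorProduct M _ (Localization.AtPrime p)]

end LocalLength

/-! ### Characteristic elements over `T_Q` -/

section CharacteristicElement

variable {T : Type u} [CommRing T] [IsDomain T] (Q : Ideal T) [Q.IsPrime]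
  {V : Type u} [CommRing V] [IsDomain V] [Algebra T V] [Algebra (Localization.AtPrime Q) V]
  [IsScalarTower T (Localization.AtPrime Q) V]

theorem exists_length_tensorProduct_eq_ord_localization [IsNoetherianRing T] [IsIntegrallyClosed T]
    [IsPrincipalIdealRing V] (hQ : Q.height = 2)
    (hker : (RingHom.ker (algebraMap (Localization.AtPrime Q) V)).height = 1)
    {Y : Type u} [AddCommGroup Y] [Module T Y] [Module.Finite T Y]
    (hY : ∃ t, algebraMap T V t ≠ 0 ∧ ∀ y : Y, t • y = 0)
    (hPN : ∀ Z : Submodule (Localization.AtPrime Q) (LocalizedModule Q.primeCompl Y),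
      IsPseudoNull (Localization.AtPrime Q) Z → Z = ⊥)
    {d : ℕ} (hd : CategoryTheory.HasProjectiveDimensionLE
      (ModuleCat.of (Localization.AtPrime Q) (LocalizedModule Q.primeCompl Y)) d) :
    ∃ f : Localization.AtPrime Q, algebraMap _ V f ≠ 0 ∧
      (∀ (p : Ideal (Localization.AtPrime Q)) [p.IsPrime], p.height = 1 →
        localLength T Y ⟨p.comap (algebraMap T (Localization.AtPrime Q)), inferInstance⟩ =
          Ring.ord (Localization.AtPrime p) (algebraMap _ (Localization.AtPrime p) f)) ∧
      Module.length V (V ⊗[T] Y) = Ring.ord V (algebraMap _ V f) := by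
  let S := Localization.AtPrime Q
  have : IsNoetherianRing S := IsLocalization.isNoetherianRing Q.primeCompl _ inferInstance
  have : IsIntegrallyClosed S :=
    isIntegrallyClosed_of_isLocalization _ Q.primeCompl Q.primeCompl_le_nonZeroDivisors
  obtain ⟨t, htV, ht⟩ := hY
  have htS : algebraMap S V (algebraMap T S t) ≠ 0 := by rwa [← IsScalarTower.algebraMap_apply]
  have htS0 : algebraMap T S t ≠ 0 := fun h => htS (by rw [h, map_zero])
  have htN : ∀ y : LocalizedModule Q.primeCompl Y, algebraMap T S t • y = 0 := fun y => by
    induction y using LocalizedModule.induction_on with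
    | h m s => rw [algebraMap_smul, LocalizedModule.smul'_mk, ht, LocalizedModule.zero_mk]
  have htors : Module.IsTorsion S (LocalizedModule Q.primeCompl Y) := fun y =>
    ⟨⟨_, mem_nonZeroDivisors_of_ne_zero htS0⟩, htN y⟩
  have hdim : (maximalIdeal S).height = 2 := by
    rw [← IsLocalization.height_under Q.primeCompl, IsLocalization.AtPrime.under_maximalIdeal S Q,
      hQ]
  obtain ⟨f, hf0, hf⟩ := exists_length_tensorProduct_eq_ord_of_noPseudoNull hdim htors hPN hd
  have key : ∀ (p : Ideal S) [p.IsPrime], p.height = 1 →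
      localLength T Y ⟨p.comap (algebraMap T S), inferInstance⟩ =
        Ring.ord (Localization.AtPrime p) (algebraMap _ (Localization.AtPrime p) f) := by
    intro p _ hp
    have := localization_atPrime_isDiscreteValuationRing p hp
    rw [← length_tensorProduct_localization_atPrime Q.primeCompl p Y,
      ← length_tensorProduct_localizedModule Q.primeCompl]
    refine hf _ ?_
    rwa [Ne, map_eq_zero_iff _ (IsLocalization.injective _ p.primeCompl_le_nonZeroDivisors)]
  -- At the height one prime `ker (S → V)` the annihilator `t` becomes a unit, so the length there
  -- is zero. Hence `f` is a unit at that prime and lies outside it.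
  have hfV : algebraMap S V f ≠ 0 := fun h => by
    have hp := RingHom.ker_isPrime (algebraMap S V)
    have h1 := key _ hker
    have := localization_atPrime_isDiscreteValuationRing _ hker
    rw [← length_tensorProduct_localization_atPrime Q.primeCompl,
      length_tensorProduct_eq_zero (t := t) ?_ ht] at h1
    · have h2 := h1.symm
      rw [Ring.ord, Module.length_eq_zero_iff, Ideal.Quotient.subsingleton_iff,
        Ideal.span_singleton_eq_top,
        IsLocalization.AtPrime.isUnit_to_map_iff _ (RingHom.ker (algebraMap S V))] at h2
      exact h2 h
    · rw [IsScalarTower.algebraMap_apply T S]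
      exact (IsLocalization.AtPrime.isUnit_to_map_iff _ (RingHom.ker (algebraMap S V)) _).2 htS
  refine ⟨f, hfV, key, ?_⟩
  rw [← length_tensorProduct_localizedModule Q.primeCompl]
  exact hf V hfV

/-- Regularity makes `ker (S → V)` principal, say `(π)`; the characteristic element of `S ⊗ M` then
works, its `π`-torsion having the length of `V ⊗ Tor₁`. -/
theorem exists_length_tensorProduct_eq_add_ord_localization
    [IsRegularLocalRing (Localization.AtPrime Q)] (hQ : Q.height = 2)
    (hker : (RingHom.ker (algebraMap (Localization.AtPrime Q) V)).height = 1)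
    (hV : Function.Surjective (algebraMap (Localization.AtPrime Q) V))
    {R : Type u} [CommRing R] [Algebra T R] [Algebra R V] [IsScalarTower T R V] [Module.Flat R V]
    {M : Type u} [AddCommGroup M] [Module T M] [Module.Finite T M]
    (hM : ∃ t, algebraMap T V t ≠ 0 ∧ ∀ m : M, t • m = 0) :
    ∃ f : Localization.AtPrime Q, algebraMap _ V f ≠ 0 ∧
      (∀ (p : Ideal (Localization.AtPrime Q)) [p.IsPrime], p.height = 1 →
        localLength T M ⟨p.comap (algebraMap T (Localization.AtPrime Q)), inferInstance⟩ =
          Ring.ord (Localization.AtPrime p) (algebraMap _ (Localization.AtPrime p) f)) ∧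
      Module.length V (V ⊗[T] M) =
        Module.length V (V ⊗[R] TorOne T R M) + Ring.ord V (algebraMap _ V f) := by
  let S := Localization.AtPrime Q
  have hp := RingHom.ker_isPrime (algebraMap S V)
  obtain ⟨t, htV, ht⟩ := hM
  have hdim : (maximalIdeal S).height = 2 := by
    rw [← IsLocalization.height_under Q.primeCompl, IsLocalization.AtPrime.under_maximalIdeal S Q,
      hQ]
  obtain ⟨π, hπ⟩ := exists_eq_span_singleton_of_height_eq_one hdim _ hker
  obtain ⟨f, hf, hfp, hfV⟩ := exists_characteristic_element hdim hV hπ (hπ ▸ hker) (S ⊗[T] M)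
    ⟨algebraMap T S t, by rwa [← IsScalarTower.algebraMap_apply], fun n => by
      rw [algebraMap_smul]
      induction n using TensorProduct.induction_on with
      | zero => simp
      | tmul s m => rw [TensorProduct.smul_tmul', TensorProduct.smul_tmul, ht, TensorProduct.tmul_zero]
      | add a b ha hb => rw [smul_add, ha, hb, add_zero]⟩
  have hπ0 : π ≠ 0 := by
    rintro rfl
    rw [hπ, Ideal.span_singleton_zero] at hker
    simp at hker
  refine ⟨f, hf, fun p _ hp => ?_, ?_⟩
  · rw [← length_tensorProduct_localization_atPrime Q.primeCompl p M, ← hfp p hp,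
      length_tensorProduct_tensorProduct]
  · rw [length_tensorProduct_torOne hπ0 hV hπ, ← hfV, ← length_tensorProduct_tensorProduct (S := S)]
    exact (Module.length_eq_of_surjective hV).symm

end CharacteristicElement

/-! ### Comparison of `T_Q` with `R_q` -/

section Normalization

variable {T R : Type u} [CommRing T] [CommRing R] [Algebra T R]

theorem isIntegral_of_algEquiv_integralClosure
    (e : R ≃ₐ[T] integralClosure (T ⧸ RingHom.ker (algebraMap T R))
      (FractionRing (T ⧸ RingHom.ker (algebraMap T R)))) : Algebra.IsIntegral T R := by
  let P := RingHom.ker (algebraMap T R)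
  have : Algebra.IsIntegral T (integralClosure (T ⧸ P) (FractionRing (T ⧸ P))) :=
    Algebra.IsIntegral.trans (T ⧸ P)
  exact Algebra.IsIntegral.of_injective e.toAlgHom e.injective

/-- `T/P` and its normalisation agree away from `Q`: an element of `R`, integral over `T/P`, already
lies in the normal ring `D = (T/P)_Q`. -/
theorem exists_mul_eq_algebraMap_of_isIntegrallyClosed {P : Ideal T} [P.IsPrime] {K : Type u}
    [Field K] [Algebra (T ⧸ P) K] [IsFractionRing (T ⧸ P) K] [Algebra T K]
    [IsScalarTower T (T ⧸ P) K] (e : R ≃ₐ[T] integralClosure (T ⧸ P) K) {Q : Ideal T} [Q.IsPrime]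
    (hQ : P ≤ Q) {D : Type u} [CommRing D] [IsIntegrallyClosed D] [Algebra (T ⧸ P) D]
    [IsLocalization (Algebra.algebraMapSubmonoid (T ⧸ P) Q.primeCompl) D] (r : R) :
    ∃ t ∉ Q, ∃ a, algebraMap T R t * r = algebraMap T R a := by
  let N := Algebra.algebraMapSubmonoid (T ⧸ P) Q.primeCompl
  have hN : N ≤ nonZeroDivisors (T ⧸ P) := by
    rintro _ ⟨t, ht, rfl⟩
    refine mem_nonZeroDivisors_of_ne_zero fun h => ht (hQ ?_)
    rwa [Ideal.Quotient.algebraMap_eq, Ideal.Quotient.eq_zero_iff_mem] at h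
  have : IsDomain D := IsLocalization.isDomain_of_le_nonZeroDivisors _ hN
  have hu : ∀ y : N, IsUnit (algebraMap (T ⧸ P) K y) := fun y =>
    IsLocalization.map_units K ⟨y.1, hN y.2⟩
  let _ : Algebra D K := (IsLocalization.lift (M := N) (S := D) hu).toAlgebra
  have : IsScalarTower (T ⧸ P) D K :=
    IsScalarTower.of_algebraMap_eq fun x => (IsLocalization.lift_eq hu x).symm
  have : IsFractionRing D K := IsFractionRing.isFractionRing_of_isDomain_of_isLocalization N D K
  have hr : IsIntegral (T ⧸ P) (e r : K) := (e r).2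
  obtain ⟨y, hy⟩ := (isIntegrallyClosed_iff K).1 ‹IsIntegrallyClosed D› (hr.tower_top (A := D))
  obtain ⟨a, ⟨_, t, ht, rfl⟩, rfl⟩ := IsLocalization.exists_mk'_eq N y
  obtain ⟨a, rfl⟩ := Ideal.Quotient.mk_surjective a
  refine ⟨t, ht, a, e.injective (Subtype.ext ?_)⟩
  rw [map_mul, e.commutes, e.commutes]
  change algebraMap T K t * (e r : K) = algebraMap T K a
  rw [IsScalarTower.algebraMap_apply T (T ⧸ P) K, IsScalarTower.algebraMap_apply T (T ⧸ P) K]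
  have h1 := congrArg (algebraMap D K)
    (IsLocalization.mk'_spec' D (Ideal.Quotient.mk P a) (⟨_, t, ht, rfl⟩ : N))
  rw [map_mul, hy, ← IsScalarTower.algebraMap_apply (T ⧸ P) D K,
    ← IsScalarTower.algebraMap_apply (T ⧸ P) D K] at h1
  exact h1

/-- If `t r = a` and `t' s = a'` with `t, t' ∉ Q`, then `r/s = a t' / (t a')`, where `a' ∉ Q`
because `s ∉ q`. In particular no other prime of `R` over `Q` interferes. -/
theorem surjective_algebraMap_localization {Q : Ideal T} [Q.IsPrime] {q : Ideal R} [q.IsPrime]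
    (hq : q.comap (algebraMap T R) = Q)
    (hR : ∀ r : R, ∃ t ∉ Q, ∃ a, algebraMap T R t * r = algebraMap T R a)
    {S V : Type*} [CommRing S] [CommRing V] [Algebra T S] [IsLocalization.AtPrime S Q]
    [Algebra R V] [IsLocalization.AtPrime V q] [Algebra S V] [Algebra T V] [IsScalarTower T S V]
    [IsScalarTower T R V] : Function.Surjective (algebraMap S V) := by
  intro v
  obtain ⟨r, ⟨s, hs⟩, rfl⟩ := IsLocalization.exists_mk'_eq q.primeCompl v
  obtain ⟨t, ht, a, hta⟩ := hR r
  obtain ⟨t', ht', a', hta'⟩ := hR s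
  have hQ : ∀ x, x ∈ Q ↔ algebraMap T R x ∈ q := fun x => by rw [← hq, Ideal.mem_comap]
  have ha' : a' ∉ Q := by
    rw [hQ, ← hta']
    exact fun h => (Ideal.IsPrime.mem_or_mem ‹_› h).elim (fun h => ht' ((hQ _).2 h)) hs
  have hta'Q : t * a' ∈ Q.primeCompl := fun h => (Ideal.IsPrime.mem_or_mem ‹_› h).elim ht ha'
  refine ⟨IsLocalization.mk' S (a * t') (⟨t * a', hta'Q⟩ : Q.primeCompl), ?_⟩
  rw [eq_comm, IsLocalization.mk'_eq_iff_eq_mul]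
  have hu : IsUnit (algebraMap T V (t * a')) := by
    rw [IsScalarTower.algebraMap_apply T S]
    exact (IsLocalization.map_units S (⟨t * a', hta'Q⟩ : Q.primeCompl)).map _
  refine hu.mul_left_cancel ?_
  have h1 : algebraMap T V (t * a') * algebraMap S V
      (IsLocalization.mk' S (a * t') (⟨t * a', hta'Q⟩ : Q.primeCompl)) = algebraMap T V (a * t') := by
    rw [IsScalarTower.algebraMap_apply T S, IsScalarTower.algebraMap_apply T S V (a * t'), ← map_mul]
    exact congrArg _ (IsLocalization.mk'_spec' S (a * t') (⟨t * a', hta'Q⟩ : Q.primeCompl))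
  rw [← mul_assoc, h1, IsScalarTower.algebraMap_apply T R V, IsScalarTower.algebraMap_apply T R V,
    ← map_mul, ← map_mul]
  congr 1
  rw [map_mul, map_mul, ← hta, ← hta']
  ring

end Normalization

/-! ### Inequalities between finite lengths, and torsion after base change -/

section ENat

theorem ENat.toNat_sub_toNat_le_iff {x y z : ℕ∞} (hx : x ≠ ⊤) (hy : y ≠ ⊤) (hz : z ≠ ⊤) :
    (y.toNat : ℤ) - z.toNat ≤ x.toNat ↔ y ≤ x + z := by
  lift x to ℕ using hx
  lift y to ℕ using hy
  lift z to ℕ using hz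
  rw [← Nat.cast_add, Nat.cast_le]
  simp only [ENat.toNat_natCast]
  omega

theorem ENat.toNat_le_toNat_sub_iff {x y z : ℕ∞} (hx : x ≠ ⊤) (hy : y ≠ ⊤) (hz : z ≠ ⊤) :
    (x.toNat : ℤ) ≤ y.toNat - z.toNat ↔ x + z ≤ y := by
  lift x to ℕ using hx
  lift y to ℕ using hy
  lift z to ℕ using hz
  rw [← Nat.cast_add, Nat.cast_le]
  simp only [ENat.toNat_natCast]
  omega

end ENat

section Torsion

theorem isTorsion_of_algebraMap_smul_eq_zero {T R : Type*} [CommRing T] [CommRing R]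
    [IsDomain R] [Algebra T R] {N : Type*} [AddCommGroup N] [Module R N] {t : T}
    (ht : algebraMap T R t ≠ 0) (h : ∀ x : N, algebraMap T R t • x = 0) : Module.IsTorsion R N :=
  fun x => ⟨⟨_, mem_nonZeroDivisors_of_ne_zero ht⟩, h x⟩

theorem algebraMap_smul_tensorProduct_eq_zero {T R : Type*} [CommRing T] [CommRing R]
    [Algebra T R] {N : Type*} [AddCommGroup N] [Module T N] {t : T} (h : ∀ x : N, t • x = 0)
    (x : R ⊗[T] N) : algebraMap T R t • x = 0 := by
  rw [algebraMap_smul]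
  induction x using TensorProduct.induction_on with
  | zero => simp
  | tmul s m => rw [TensorProduct.smul_tmul', TensorProduct.smul_tmul, h, TensorProduct.tmul_zero]
  | add a b ha hb => rw [smul_add, ha, hb, add_zero]

end Torsion

/-! ### The inequality at one height one prime of `R` -/

section Specialisation

variable {T R : Type u} [CommRing T] [IsDomain T] [IsNoetherianRing T] [IsIntegrallyClosed T]
  [CommRing R] [IsDomain R] [IsNoetherianRing R] [IsIntegrallyClosed R] [Algebra T R]

/-- The comparison of local lengths at a height one prime `q` of `R` that lies over a prime of
height two of `T`. -/
theorem localLength_comparison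
    (hker : (RingHom.ker (algebraMap T R)).height = 1)
    (e : R ≃ₐ[T] integralClosure (T ⧸ RingHom.ker (algebraMap T R))
      (FractionRing (T ⧸ RingHom.ker (algebraMap T R))))
    {Y₁ Y₂ M : Type u} [AddCommGroup Y₁] [Module T Y₁] [Module.Finite T Y₁]
    [AddCommGroup Y₂] [Module T Y₂] [Module.Finite T Y₂]
    [AddCommGroup M] [Module T M] [Module.Finite T M]
    (hY₁ : ∃ t, algebraMap T R t ≠ 0 ∧ ∀ y : Y₁, t • y = 0)
    (hY₂ : ∃ t, algebraMap T R t ≠ 0 ∧ ∀ y : Y₂, t • y = 0)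
    (hM : ∃ t, algebraMap T R t ≠ 0 ∧ ∀ y : M, t • y = 0)
    (hPN₁ : NoPN T (RingHom.ker (algebraMap T R)) Y₁)
    (hPN₂ : NoPN T (RingHom.ker (algebraMap T R)) Y₂)
    (hFP₁ : FinProj T (RingHom.ker (algebraMap T R)) Y₁)
    (hFP₂ : FinProj T (RingHom.ker (algebraMap T R)) Y₂)
    (hreg : ∀ (Q : PrimeSpectrum T), Q.asIdeal.height = 2 →
      RingHom.ker (algebraMap T R) ≤ Q.asIdeal → Q ∈ Module.support T M →
        IsRegularLocalRing (Localization.AtPrime Q.asIdeal) ∧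
        IsIntegrallyClosed (Localization (Algebra.algebraMapSubmonoid
          (T ⧸ RingHom.ker (algebraMap T R)) Q.asIdeal.primeCompl)))
    (q : HeightOnePrime R) (hq : (q.1.asIdeal.comap (algebraMap T R)).height = 2) :
    ((∀ p : HeightOnePrime T,
        localLength T Y₂ p.1 ≤ localLength T Y₁ p.1 + localLength T M p.1) →
      localLength R (R ⊗[T] Y₂) q.1 + localLength R (TorOne T R M) q.1 ≤
        localLength R (R ⊗[T] Y₁) q.1 + localLength R (R ⊗[T] M) q.1) ∧
    ((∀ p : HeightOnePrime T,
        localLength T Y₁ p.1 + localLength T M p.1 ≤ localLength T Y₂ p.1) →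
      localLength R (R ⊗[T] Y₁) q.1 + localLength R (R ⊗[T] M) q.1 ≤
        localLength R (R ⊗[T] Y₂) q.1 + localLength R (TorOne T R M) q.1) := by
  obtain ⟨⟨q, hqp⟩, hq1⟩ := q
  dsimp only at hq hq1 ⊢
  let Q : Ideal T := q.comap (algebraMap T R)
  let S := Localization.AtPrime Q
  let V := Localization.AtPrime q
  let _ : Algebra S V := (Localization.localRingHom Q q (algebraMap T R) rfl).toAlgebra
  have : IsScalarTower T S V := IsScalarTower.of_algebraMap_eq fun t => by
    rw [IsScalarTower.algebraMap_apply T R V]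
    exact (Localization.localRingHom_to_map Q q (algebraMap T R) rfl t).symm
  have hPQ : RingHom.ker (algebraMap T R) ≤ Q := by
    rw [RingHom.ker_eq_comap_bot]
    exact Ideal.comap_mono bot_le
  have : IsNoetherianRing S := IsLocalization.isNoetherianRing Q.primeCompl _ inferInstance
  have : IsIntegrallyClosed S :=
    isIntegrallyClosed_of_isLocalization _ Q.primeCompl Q.primeCompl_le_nonZeroDivisors
  have : IsDiscreteValuationRing V := localization_atPrime_isDiscreteValuationRing q hq1
  have hRV : Function.Injective (algebraMap R V) :=
    IsLocalization.injective _ q.primeCompl_le_nonZeroDivisors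
  have hTV : ∀ t, algebraMap T V t ≠ 0 ↔ algebraMap T R t ≠ 0 := fun t => by
    rw [IsScalarTower.algebraMap_apply T R V, Ne, map_eq_zero_iff _ hRV]
  -- This kernel contracts to `ker ϖ` in `T`, and localisation preserves heights.
  have hkerS : (RingHom.ker (algebraMap S V)).height = 1 := by
    have := RingHom.ker_isPrime (algebraMap S V)
    rw [← IsLocalization.height_under Q.primeCompl, ← hker]
    congr 1
    ext t
    rw [Ideal.mem_comap, RingHom.mem_ker, RingHom.mem_ker, ← IsScalarTower.algebraMap_apply,
      ← not_iff_not]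
    exact hTV t
  have hlen : ∀ (N : Type u) [AddCommGroup N] [Module T N],
      localLength R (R ⊗[T] N) ⟨q, hqp⟩ = Module.length V (V ⊗[T] N) := fun N _ _ => by
    rw [localLength_eq_length_tensorProduct _ _ V, length_tensorProduct_tensorProduct]
  have hTor : localLength R (TorOne T R M) ⟨q, hqp⟩ = Module.length V (V ⊗[R] TorOne T R M) :=
    localLength_eq_length_tensorProduct _ _ V
  obtain ⟨d₁, hd₁⟩ := hFP₁ Q hq hPQ
  obtain ⟨d₂, hd₂⟩ := hFP₂ Q hq hPQ
  obtain ⟨f₁, hf₁, hf₁p, hf₁V⟩ := exists_length_tensorProduct_eq_ord_localization (V := V) Q hq hkerS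
    (by simpa only [hTV] using hY₁) (hPN₁ Q hq hPQ) hd₁
  obtain ⟨f₂, hf₂, hf₂p, hf₂V⟩ := exists_length_tensorProduct_eq_ord_localization (V := V) Q hq hkerS
    (by simpa only [hTV] using hY₂) (hPN₂ Q hq hPQ) hd₂
  obtain ⟨g, hg, hgp, hgV⟩ : ∃ f : S, algebraMap S V f ≠ 0 ∧
      (∀ (p : Ideal S) [p.IsPrime], p.height = 1 →
        localLength T M ⟨p.comap (algebraMap T S), inferInstance⟩ =
          Ring.ord (Localization.AtPrime p) (algebraMap _ (Localization.AtPrime p) f)) ∧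
      Module.length V (V ⊗[T] M) =
        Module.length V (V ⊗[R] TorOne T R M) + Ring.ord V (algebraMap S V f) := by
    -- Regularity and normality at `Q` are available only on the support of `M`; off it `M_Q = 0`,
    -- all lengths vanish and `1` is a characteristic element.
    by_cases hQM : (⟨Q, inferInstance⟩ : PrimeSpectrum T) ∈ Module.support T M
    · obtain ⟨h1, h2⟩ := hreg ⟨Q, inferInstance⟩ hq hPQ hQM
      have := RingHom.ker_isPrime (algebraMap T R)
      exact exists_length_tensorProduct_eq_add_ord_localization (V := V) Q hq hkerS
        (surjective_algebraMap_localization (Q := Q) (q := q) rfl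
          (exists_mul_eq_algebraMap_of_isIntegrallyClosed e hPQ
            (D := Localization (Algebra.algebraMapSubmonoid
              (T ⧸ RingHom.ker (algebraMap T R)) Q.primeCompl))))
        (by simpa only [hTV] using hM)
    · obtain ⟨t, htQ, ht⟩ := exists_smul_eq_zero_of_notMem_support hQM
      have htS : IsUnit (algebraMap T S t) := IsLocalization.map_units S (⟨t, htQ⟩ : Q.primeCompl)
      refine ⟨1, by simp, fun p _ hp => ?_, ?_⟩
      · rw [← length_tensorProduct_localization_atPrime Q.primeCompl p M, map_one, Ring.ord_one]
        refine length_tensorProduct_eq_zero (t := t) ?_ ht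
        rw [IsScalarTower.algebraMap_apply T S]
        exact htS.map _
      · have htV : IsUnit (algebraMap T V t) := by
          rw [IsScalarTower.algebraMap_apply T S]
          exact htS.map _
        rw [map_one, Ring.ord_one, length_tensorProduct_eq_zero htV ht,
          length_tensorProduct_eq_zero (t := algebraMap T R t) ?_ (smul_torOne_eq_zero ht), add_zero]
        rwa [← IsScalarTower.algebraMap_apply]
  have hne : ∀ {f : S}, algebraMap S V f ≠ 0 → f ≠ 0 := fun h h0 => h (by rw [h0, map_zero])
  have hf₁0 := hne hf₁
  have hf₂0 := hne hf₂
  have hg0 := hne hg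
  have hone : ∀ (p : Ideal S) [p.IsPrime], p.height = 1 →
      (p.comap (algebraMap T S)).height = 1 := fun p _ hp => by
    rw [← hp]
    exact IsLocalization.height_under Q.primeCompl p
  have hmul : ∀ (p : Ideal S) [p.IsPrime], p.height = 1 →
      Ring.ord (Localization.AtPrime p) (algebraMap S (Localization.AtPrime p) (f₁ * g)) =
        localLength T Y₁ ⟨p.comap (algebraMap T S), inferInstance⟩ +
          localLength T M ⟨p.comap (algebraMap T S), inferInstance⟩ := fun p _ hp => by
    rw [map_mul, Ring.ord_mul, hf₁p p hp, hgp p hp]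
    exact mem_nonZeroDivisors_of_ne_zero
      (by rwa [Ne, map_eq_zero_iff _ (IsLocalization.injective _ p.primeCompl_le_nonZeroDivisors)])
  have hmulV : Ring.ord V (algebraMap S V (f₁ * g)) =
      Ring.ord V (algebraMap S V f₁) + Ring.ord V (algebraMap S V g) := by
    rw [map_mul, Ring.ord_mul]
    exact mem_nonZeroDivisors_of_ne_zero hg
  rw [hlen, hlen, hlen, hTor, hf₁V, hf₂V, hgV]
  constructor
  · intro h
    -- Height one primes of `S` contract to height one primes of `T`, where the hypothesis compares
    -- orders. After applying `ord_V`, the length of `Tor₁` is added to both sides.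
    have hdvd : f₂ ∣ f₁ * g := dvd_of_forall_ord_le hf₂0 fun p _ hp => by
      rw [hmul p hp, ← hf₂p p hp]
      exact h ⟨⟨_, _⟩, hone p hp⟩
    have hle := Ring.ord_le_ord_of_dvd (map_dvd (algebraMap S V) hdvd)
    rw [hmulV] at hle
    calc _ ≤ _ := add_le_add_left hle _
      _ = _ := by ring
  · intro h
    have hdvd : f₁ * g ∣ f₂ := dvd_of_forall_ord_le (mul_ne_zero hf₁0 hg0) fun p _ hp => by
      rw [hmul p hp, ← hf₂p p hp]
      exact h ⟨⟨_, _⟩, hone p hp⟩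
    have hle := Ring.ord_le_ord_of_dvd (map_dvd (algebraMap S V) hdvd)
    rw [hmulV] at hle
    calc _ = _ := by ring
      _ ≤ _ := add_le_add_left hle _

end Specialisation

/-! ### Contractions to `T` have height two; the theorem -/

section PowerSeriesExtension

theorem height_comap_eq_two_of_finite_mvPowerSeries {O : Type*} [CommRing O] [IsDomain O]
    [IsDiscreteValuationRing O] {n : ℕ} {T R : Type*} [CommRing T] [IsNoetherianRing T]
    [Algebra (MvPowerSeries (Fin (n + 1)) O) T] [Module.Finite (MvPowerSeries (Fin (n + 1)) O) T]
    [CommRing R] [IsDomain R] [IsNoetherianRing R] [Algebra (MvPowerSeries (Fin n) O) R]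
    [Module.Finite (MvPowerSeries (Fin n) O) R]
    (hR : Function.Injective (algebraMap (MvPowerSeries (Fin n) O) R))
    [Algebra T R] [Algebra.IsIntegral T R] (hker : (RingHom.ker (algebraMap T R)).height = 1)
    {q : Ideal R} [q.IsPrime] (hq : q.height = 1) : (q.comap (algebraMap T R)).height = 2 := by
  obtain ⟨-, hdim, -⟩ := MvPowerSeries.isIntegrallyClosed_and_ringKrullDim (O := O) (n + 1)
  obtain ⟨_, -, hA⟩ := MvPowerSeries.isIntegrallyClosed_and_ringKrullDim (O := O) n
  have : IsDomain (MvPowerSeries (Fin n) O) := NoZeroDivisors.to_isDomain _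
  have : FaithfulSMul (MvPowerSeries (Fin n) O) R := (faithfulSMul_iff_algebraMap_injective _ _).2 hR
  refine Ideal.height_comap_eq_two hA ?_ hker hq
  refine (ringKrullDim_le_of_isIntegral
    (algebraMap_isIntegral_iff.2 (inferInstanceAs
      (Algebra.IsIntegral (MvPowerSeries (Fin (n + 1)) O) T)))).trans (hdim.le.trans (le_of_eq ?_))
  push_cast
  rw [add_assoc, one_add_one_eq_two]

end PowerSeriesExtension

end

/-- Here `n` counts the variables below `R`, so `T` has `n + 1` and the requirement of at least one
variable is built in. -/
theorem mainTheorem4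
    {p : ℕ} [Fact p.Prime] {n : ℕ}
    -- `T` is an integrally closed domain, finite over `ℤ_p[[u_1, ..., u_{n+1}]]`
    {T : Type u} [CommRing T] [IsDomain T] [IsIntegrallyClosed T]
    [Algebra (MvPowerSeries (Fin (n + 1)) ℤ_[p]) T]
    [Module.Finite (MvPowerSeries (Fin (n + 1)) ℤ_[p]) T]
    (hT : Function.Injective (algebraMap (MvPowerSeries (Fin (n + 1)) ℤ_[p]) T))
    -- `R` is an integrally closed domain, finite over `ℤ_p[[v_1, ..., v_n]]`
    {R : Type u} [CommRing R] [IsDomain R] [IsIntegrallyClosed R]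
    [Algebra (MvPowerSeries (Fin n) ℤ_[p]) R]
    [Module.Finite (MvPowerSeries (Fin n) ℤ_[p]) R]
    (hR : Function.Injective (algebraMap (MvPowerSeries (Fin n) ℤ_[p]) R))
    -- the ring map `ϖ : T → R` is `algebraMap T R`; its kernel has height one
    [Algebra T R]
    (hker : (RingHom.ker (algebraMap T R)).height = 1)
    -- via `ϖ`, `R` is the integral closure of `T / ker ϖ` in its field of fractions
    (hnorm : Nonempty (R ≃ₐ[T] integralClosure (T ⧸ RingHom.ker (algebraMap T R))
      (FractionRing (T ⧸ RingHom.ker (algebraMap T R)))))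
    -- finitely generated torsion `T`-modules
    {Y₁ Y₂ M : Type u} [AddCommGroup Y₁] [Module T Y₁] [Module.Finite T Y₁]
    [AddCommGroup Y₂] [Module T Y₂] [Module.Finite T Y₂]
    [AddCommGroup M] [Module T M] [Module.Finite T M]
    (hY₁ : Module.IsTorsion T Y₁) (hY₂ : Module.IsTorsion T Y₂) (hM : Module.IsTorsion T M)
    -- `ker ϖ` is not in the support of these modules
    (hsuppY₁ : (⟨RingHom.ker (algebraMap T R), RingHom.ker_isPrime _⟩ : PrimeSpectrum T) ∉
      Module.support T Y₁)
    (hsuppY₂ : (⟨RingHom.ker (algebraMap T R), RingHom.ker_isPrime _⟩ : PrimeSpectrum T) ∉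
      Module.support T Y₂)
    (hsuppM : (⟨RingHom.ker (algebraMap T R), RingHom.ker_isPrime _⟩ : PrimeSpectrum T) ∉
      Module.support T M)
    -- conditions No-PN and Fin-Proj
    (hPN₁ : NoPN T (RingHom.ker (algebraMap T R)) Y₁)
    (hPN₂ : NoPN T (RingHom.ker (algebraMap T R)) Y₂)
    (hFP₁ : FinProj T (RingHom.ker (algebraMap T R)) Y₁)
    (hFP₂ : FinProj T (RingHom.ker (algebraMap T R)) Y₂)
    -- at height two primes `Q ⊇ ker ϖ` in the support of `M`, the ring `T_Q` is regular and
    -- `(T / ker ϖ)_Q` is integrally closed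
    (hreg : ∀ (Q : PrimeSpectrum T), Q.asIdeal.height = 2 →
      RingHom.ker (algebraMap T R) ≤ Q.asIdeal → Q ∈ Module.support T M →
        IsRegularLocalRing (Localization.AtPrime Q.asIdeal) ∧
        IsIntegrallyClosed (Localization (Algebra.algebraMapSubmonoid
          (T ⧸ RingHom.ker (algebraMap T R)) Q.asIdeal.primeCompl))) :
    -- the four `R`-modules in the conclusion are finitely generated and torsion
    (Module.Finite R (R ⊗[T] Y₁) ∧ Module.IsTorsion R (R ⊗[T] Y₁)) ∧
    (Module.Finite R (R ⊗[T] Y₂) ∧ Module.IsTorsion R (R ⊗[T] Y₂)) ∧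
    (Module.Finite R (R ⊗[T] M) ∧ Module.IsTorsion R (R ⊗[T] M)) ∧
    (Module.Finite R (TorOne T R M) ∧ Module.IsTorsion R (TorOne T R M)) ∧
    -- the specialisation of the inequalities
    (divisor T Y₁ ≥ divisor T Y₂ - divisor T M →
      divisor R (R ⊗[T] Y₁) ≥ divisor R (R ⊗[T] Y₂) + divisor R (TorOne T R M) - divisor R (R ⊗[T] M)) ∧
    (divisor T Y₁ ≤ divisor T Y₂ - divisor T M →
      divisor R (R ⊗[T] Y₁) ≤ divisor R (R ⊗[T] Y₂) + divisor R (TorOne T R M) - divisor R (R ⊗[T] M)) := by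
  have hTn : IsNoetherianRing T := IsNoetherianRing.of_finite (MvPowerSeries (Fin (n + 1)) ℤ_[p]) T
  have hRn : IsNoetherianRing R := IsNoetherianRing.of_finite (MvPowerSeries (Fin n) ℤ_[p]) R
  obtain ⟨e⟩ := hnorm
  have hint : Algebra.IsIntegral T R := isIntegral_of_algEquiv_integralClosure e
  -- Being off the support provides annihilators outside `ker ϖ`; their nonzero images in `R` kill
  -- the tensor products and `Tor₁`.
  obtain ⟨t₁, ht₁, hk₁⟩ := exists_smul_eq_zero_of_notMem_support hsuppY₁
  obtain ⟨t₂, ht₂, hk₂⟩ := exists_smul_eq_zero_of_notMem_support hsuppY₂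
  obtain ⟨t, ht, hk⟩ := exists_smul_eq_zero_of_notMem_support hsuppM
  have hTor : Module.Finite R (TorOne T R M) := finite_torOne T R M
  have hRY₁ : Module.IsTorsion R (R ⊗[T] Y₁) :=
    isTorsion_of_algebraMap_smul_eq_zero ht₁ (algebraMap_smul_tensorProduct_eq_zero hk₁)
  have hRY₂ : Module.IsTorsion R (R ⊗[T] Y₂) :=
    isTorsion_of_algebraMap_smul_eq_zero ht₂ (algebraMap_smul_tensorProduct_eq_zero hk₂)
  have hRM : Module.IsTorsion R (R ⊗[T] M) :=
    isTorsion_of_algebraMap_smul_eq_zero ht (algebraMap_smul_tensorProduct_eq_zero hk)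
  have hRTor : Module.IsTorsion R (TorOne T R M) :=
    isTorsion_of_algebraMap_smul_eq_zero ht (smul_torOne_eq_zero hk)
  have key := fun q : HeightOnePrime R => localLength_comparison hker e ⟨t₁, ht₁, hk₁⟩
    ⟨t₂, ht₂, hk₂⟩ ⟨t, ht, hk⟩ hPN₁ hPN₂ hFP₁ hFP₂ hreg q
    (height_comap_eq_two_of_finite_mvPowerSeries (O := ℤ_[p]) hR hker q.2)
  -- The two positive terms are merged so that both sides have the shape `x` versus `y - z`;
  -- finiteness of the lengths is what lets `toNat` respect the sum.
  have hsum : ∀ q : HeightOnePrime R, ((localLength R (R ⊗[T] Y₂) q.1).toNat : ℤ) +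
      (localLength R (TorOne T R M) q.1).toNat =
        (localLength R (R ⊗[T] Y₂) q.1 + localLength R (TorOne T R M) q.1).toNat := fun q => by
    rw [ENat.toNat_add (localLength_ne_top R _ hRY₂ q) (localLength_ne_top R _ hRTor q)]
    push_cast
    rfl
  have hsum_ne_top : ∀ q : HeightOnePrime R,
      localLength R (R ⊗[T] Y₂) q.1 + localLength R (TorOne T R M) q.1 ≠ ⊤ := fun q =>
    WithTop.add_ne_top.2 ⟨localLength_ne_top R _ hRY₂ q, localLength_ne_top R _ hRTor q⟩
  refine ⟨⟨inferInstance, hRY₁⟩, ⟨inferInstance, hRY₂⟩, ⟨inferInstance, hRM⟩, ⟨hTor, hRTor⟩,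
    fun h q => ?_, fun h q => ?_⟩ <;>
  rw [Finsupp.sub_apply, Finsupp.add_apply, divisor_apply R _ hRY₁, divisor_apply R _ hRY₂,
    divisor_apply R _ hRM, divisor_apply R _ hRTor, hsum]
  · refine (ENat.toNat_sub_toNat_le_iff (localLength_ne_top R _ hRY₁ q) (hsum_ne_top q)
      (localLength_ne_top R _ hRM q)).2 ((key q).1 fun a => ?_)
    have h1 := h a
    rw [Finsupp.sub_apply, divisor_apply T _ hY₁, divisor_apply T _ hY₂, divisor_apply T _ hM] at h1
    exact (ENat.toNat_sub_toNat_le_iff (localLength_ne_top T _ hY₁ a) (localLength_ne_top T _ hY₂ a)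
      (localLength_ne_top T _ hM a)).1 h1
  · refine (ENat.toNat_le_toNat_sub_iff (localLength_ne_top R _ hRY₁ q) (hsum_ne_top q)
      (localLength_ne_top R _ hRM q)).2 ((key q).2 fun a => ?_)
    have h1 := h a
    rw [Finsupp.sub_apply, divisor_apply T _ hY₁, divisor_apply T _ hY₂, divisor_apply T _ hM] at h1
    exact (ENat.toNat_le_toNat_sub_iff (localLength_ne_top T _ hY₁ a) (localLength_ne_top T _ hY₂ a)
      (localLength_ne_top T _ hM a)).1 h1
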